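/- Let $n,m\ge 0$ and let $w_{i,j}\ge 0$ be weights for $0\le i\le n$, $0\le j\le m$, $(i,j)\ne(0,0)$. Let $\beta>\tfrac12$ and $\gamma\in[0,1)$. Consider the single-scan fractional free energy problem of minimising $$F(q)=\sum_{i=1}^n\sum_{j=0}^m q_{i,j}\log\frac{q_{i,j}}{w_{i,j}}+\beta\sum_{j=1}^m q_{0,j}\log\frac{q_{0,j}}{w_{0,j}}-\gamma\sum_{i=1}^n\sum_{j=1}^m(1-q_{i,j})\log(1-q_{i,j})$$ (with $0\log 0=0$) over all arrays $q_{i,j}\ge 0$ with $\sum_{j=0}^m q_{i,j}=1$ for $1\le i\le n$, $\sum_{i=0}^n q_{i,j}=1$ for $1\le j\le m$, and $q_{i,j}=0$ whenever $w_{i,j}=0$ (such entries are fixed and contribute $0$ to $F$). The standard single-scan subproblem is the case $w_{0,j}=1$ for all $j$. Assume that a feasible point in the relative interior exists, i.e. a feasible $q$ with $0<q_{i,j}<1$ for all $(i,j)$ such that $w_{i,j}>0$. Then the problem has a unique minimiser $q^*$, and $q^*$ lies in the relative interior in the same sense. Moreover, let $y^{(0)}$ be any array with positive entries, indexed like $w$,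 and put $\kappa=\beta-\gamma$. For $k\ge 0$ and $1\le i\le n$, $1\le j\le m$, define the fractional belief propagation (BP) messages $$x^{(k+1)}_{i,j}=e^{\kappa}\Big(w_{0,j}y^{(k)}_{0,j}+\sum_{i'=1}^n w_{i',j}y^{(k)}_{i',j}\Big)^{-(1-\gamma)}\Big(w_{0,j}y^{(k)}_{0,j}+\sum_{1\le i'\le n,\,i'\neq i}w_{i',j}y^{(k)}_{i',j}\Big)^{-\gamma},$$ $$x^{(k+1)}_{i,0}=1,\qquad x^{(k+1)}_{0,j}=\Big(w_{0,j}y^{(k)}_{0,j}+\sum_{i'=1}^n w_{i',j}y^{(k)}_{i',j}\Big)^{-1},$$ $$y^{(k+1)}_{i,j}=e^{\kappa}\Big(w_{i,0}x^{(k+1)}_{i,0}+\sum_{j'=1}^m w_{i,j'}x^{(k+1)}_{i,j'}\Big)^{-(1-\gamma)}\Big(w_{i,0}x^{(k+1)}_{i,0}+\sum_{1\le j'\le m,\,j'\neq j}w_{i,j'}x^{(k+1)}_{i,j'}\Big)^{-\gamma},$$ $$y^{(k+1)}_{i,0}=\Big(w_{i,0}x^{(k+1)}_{i,0}+\sum_{j'=1}^m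 w_{i,j'}x^{(k+1)}_{i,j'}\Big)^{-1},\qquad y^{(k+1)}_{0,j}=\big(x^{(k+1)}_{0,j}\big)^{\frac1\beta-1}.$$ Then the messages $x^{(k)}$, $y^{(k)}$ converge entrywise, as $k\to\infty$, to positive limits that form a fixed point of the two update maps. The beliefs obtained after either half of an iteration converge to $q^*$. These beliefs are, after the first half, $$q_{i,j}=w_{i,j}\,y^{(k)}_{i,j}\,x^{(k+1)}_{0,j},\qquad q_{i,0}=w_{i,0}\,y^{(k)}_{i,0},\qquad q_{0,j}=w_{0,j}\big(x^{(k+1)}_{0,j}\big)^{1/\beta},$$ and, after the second half, $$q_{i,j}=w_{i,j}\,x^{(k+1)}_{i,j}\,y^{(k+1)}_{i,0},\qquad q_{i,0}=w_{i,0}\,y^{(k+1)}_{i,0},\qquad q_{0,j}=w_{0,j}\big(x^{(k+1)}_{0,j}\big)^{1/\beta}.$$ -/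

import Mathlib

namespace FractionalBP

/-- A family of reals indexed by the pairs `(i, j)`, `0 ≤ i ≤ n`, `0 ≤ j ≤ m`, `(i, j) ≠ (0, 0)`:
`pair i j` is the entry at a target `i` and a measurement `j`, `miss i` is the entry `(i, 0)`
(target `i` is not detected) and `fa j` is the entry `(0, j)` (measurement `j` is a false alarm).
Weights, beliefs and messages are all of this shape. -/
@[ext]
structure Arr (n m : ℕ) where
  pair : Fin n → Fin m → ℝ
  miss : Fin n → ℝ
  fa : Fin m → ℝ

variable {n m : ℕ}

/-- All entries are nonnegative. -/
def Arr.Nonneg (w : Arr n m) : Prop :=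
  (∀ i j, 0 ≤ w.pair i j) ∧ (∀ i, 0 ≤ w.miss i) ∧ (∀ j, 0 ≤ w.fa j)

/-- All entries are positive. -/
def Arr.Pos (y : Arr n m) : Prop :=
  (∀ i j, 0 < y.pair i j) ∧ (∀ i, 0 < y.miss i) ∧ (∀ j, 0 < y.fa j)

/-- Entrywise convergence of a sequence of arrays. -/
def Arr.ConvergesTo (u : ℕ → Arr n m) (a : Arr n m) : Prop :=
  (∀ i j, Filter.Tendsto (fun k => (u k).pair i j) Filter.atTop (nhds (a.pair i j))) ∧
  (∀ i, Filter.Tendsto (fun k => (u k).miss i) Filter.atTop (nhds (a.miss i))) ∧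
  (∀ j, Filter.Tendsto (fun k => (u k).fa j) Filter.atTop (nhds (a.fa j)))

/-- The single-scan fractional free energy, where `α`, `β` are the coefficients of the missed
detection and of the false alarm terms and `γ` is the fractional coefficient.
The convention `0 log 0 = 0` is that of `Real.log`; a term with `w = 0` vanishes. -/
noncomputable def freeEnergy (α β γ : ℝ) (w q : Arr n m) : ℝ :=
  (∑ i, ∑ j, q.pair i j * Real.log (q.pair i j / w.pair i j))
    + α * (∑ i, q.miss i * Real.log (q.miss i / w.miss i))
    + β * (∑ j, q.fa j * Real.log (q.fa j / w.fa j))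
    - γ * (∑ i, ∑ j, (1 - q.pair i j) * Real.log (1 - q.pair i j))

/-- The constraints of the single-scan problem. Entries of zero weight are fixed to zero. -/
structure Feasible (w q : Arr n m) : Prop where
  nonneg : q.Nonneg
  row_sum : ∀ i, q.miss i + ∑ j, q.pair i j = 1
  col_sum : ∀ j, q.fa j + ∑ i, q.pair i j = 1
  pair_zero : ∀ i j, w.pair i j = 0 → q.pair i j = 0
  miss_zero : ∀ i, w.miss i = 0 → q.miss i = 0
  fa_zero : ∀ j, w.fa j = 0 → q.fa j = 0

/-- Feasible points in the relative interior: every entry of positive weight is strictly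
between `0` and `1`. -/
structure InteriorFeasible (w q : Arr n m) : Prop where
  feasible : Feasible w q
  pair_mem : ∀ i j, 0 < w.pair i j → q.pair i j ∈ Set.Ioo (0 : ℝ) 1
  miss_mem : ∀ i, 0 < w.miss i → q.miss i ∈ Set.Ioo (0 : ℝ) 1
  fa_mem : ∀ j, 0 < w.fa j → q.fa j ∈ Set.Ioo (0 : ℝ) 1

/-- `q` minimises the fractional free energy over the feasible set. -/
def IsMinimiser (α β γ : ℝ) (w q : Arr n m) : Prop :=
  Feasible w q ∧ ∀ q', Feasible w q' → freeEnergy α β γ w q ≤ freeEnergy α β γ w q'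

/-- First half-iteration `x = r(y)`, with `κ = α + β - 1 - γ`. -/
noncomputable def stepR (α β γ : ℝ) (w y : Arr n m) : Arr n m where
  pair i j :=
    (w.fa j * y.fa j + ∑ i', w.pair i' j * y.pair i' j) ^ (-(1 - γ))
      * (w.fa j * y.fa j + ∑ i' ∈ Finset.univ.erase i, w.pair i' j * y.pair i' j) ^ (-γ)
      * Real.exp (α + β - 1 - γ)
  miss i := (y.miss i) ^ (1 / α - 1)
  fa j := (w.fa j * y.fa j + ∑ i', w.pair i' j * y.pair i' j)⁻¹

/-- Second half-iteration `y = s(x)`, with `κ = α + β - 1 - γ`. -/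
noncomputable def stepS (α β γ : ℝ) (w x : Arr n m) : Arr n m where
  pair i j :=
    (w.miss i * x.miss i + ∑ j', w.pair i j' * x.pair i j') ^ (-(1 - γ))
      * (w.miss i * x.miss i + ∑ j' ∈ Finset.univ.erase j, w.pair i j' * x.pair i j') ^ (-γ)
      * Real.exp (α + β - 1 - γ)
  miss i := (w.miss i * x.miss i + ∑ j', w.pair i j' * x.pair i j')⁻¹
  fa j := (x.fa j) ^ (1 / β - 1)

/-- The messages `y⁽ᵏ⁾`, started from `y⁽⁰⁾ = y₀`. -/
noncomputable def yMsg (α β γ : ℝ) (w y₀ : Arr n m) : ℕ → Arr n m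
  | 0 => y₀
  | k + 1 => stepS α β γ w (stepR α β γ w (yMsg α β γ w y₀ k))

/-- The messages `x⁽ᵏ⁺¹⁾ = r(y⁽ᵏ⁾)`. -/
noncomputable def xMsg (α β γ : ℝ) (w y₀ : Arr n m) (k : ℕ) : Arr n m :=
  stepR α β γ w (yMsg α β γ w y₀ k)

/-- The beliefs computed from `y⁽ᵏ⁾` and `x⁽ᵏ⁺¹⁾`, i.e. after the first half of an iteration
(each column sum over the targets and the false alarm event is normalised by `x.fa j`). -/
noncomputable def beliefR (α β : ℝ) (w y x : Arr n m) : Arr n m where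
  pair i j := w.pair i j * y.pair i j * x.fa j
  miss i := w.miss i * (y.miss i) ^ (1 / α)
  fa j := w.fa j * (x.fa j) ^ (1 / β)

/-- The beliefs computed from `x⁽ᵏ⁺¹⁾` and `y⁽ᵏ⁺¹⁾`, i.e. after the second half of an iteration
(each row sum over the measurements and the missed detection is normalised by `y.miss i`). -/
noncomputable def beliefS (α β : ℝ) (w x y : Arr n m) : Arr n m where
  pair i j := w.pair i j * x.pair i j * y.miss i
  miss i := w.miss i * (y.miss i) ^ (1 / α)
  fa j := w.fa j * (x.fa j) ^ (1 / β)

end FractionalBP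

namespace FractionalBP

open Filter Topology Function

variable {n m : ℕ}

/-! Two facts combine: the free energy is strictly convex along the feasible set, and a full BP
iteration, read on the logarithms of the messages, is nonexpansive for the supremum norm. A
coefficient α > 1/2 is carried on the missed detections too, so that exchanging targets and
measurements turns the second half-iteration into the first; the theorem is the case α = 1.

Optimisation. In a row or a column, `sum_sq_div_one_sub_le` bounds ∑ d²/(1-q) by ∑ d²/q. Charging
half of the negative curvature of the fractional terms to the rows and half to the columns leaves a
Hessian of at least (1-γ)/2 ∑ d²/q (`le_hess`). This makes the inner stationary point unique
(`Stationary.eq`), and the blow-up of the bound at vanishing entries drives minimisers inside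
(`IsMinFn.isInner`). Exponentials of Lagrange multipliers at the minimiser build a BP fixed point;
conversely, the beliefs of any positive fixed point satisfy the multiplier conditions, so they are
the minimiser. The limiting messages may depend on the start, but the limiting beliefs do not.

Dynamics. Nonexpansiveness and a fixed point only give bounded orbits. However, α, β > 1/2 makes the
copied entries contract strictly, and a log-sum-exp transmits a full difference only if all its
weighted arguments carry it. So a difference of full size always traces back to a pair of positive
weight, and at such a pair it was already present with the same sign. On a limit orbit whose
increments had constant norm c > 0, some pair coordinate would move by the same ±c forever, against
boundedness (`exists_tendsto_iterate_of_nonexpansive`). -/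

/-! ### Orbits of nonexpansive maps in the supremum norm -/

/-- A map that is nonexpansive for the supremum norm and has a fixed point, such that an extremal
difference at a coordinate of `P` was already present with the same sign before the map was
applied, and such that extremal differences only come from extremal differences on `P`, has only
convergent orbits. -/
theorem exists_tendsto_iterate_of_nonexpansive {ι : Type*} [Fintype ι] (T : (ι → ℝ) → ι → ℝ)
    (P : Set ι) (hT : LipschitzWith 1 T)
    (hP : ∀ u v e, 0 < ‖u - v‖ → |T u e - T v e| = ‖u - v‖ → ∃ p ∈ P, |u p - v p| = ‖u - v‖)
    (hdiag : ∀ u v, ∀ p ∈ P, 0 < ‖u - v‖ → T u p - T v p = ‖u - v‖ → u p - v p = ‖u - v‖)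
    (hfix : ∃ z, T z = z) (u : ι → ℝ) :
    ∃ z, T z = z ∧ Tendsto (fun k => T^[k] u) atTop (𝓝 z) := by
  obtain ⟨z₀, hz₀⟩ := hfix
  have hstep : ∀ a b, ‖T a - T b‖ ≤ ‖a - b‖ := fun a b => by
    simpa [dist_eq_norm] using hT.dist_le_mul a b
  have hbdd : ∀ (a : ι → ℝ) k, ‖T^[k] a - z₀‖ ≤ ‖a - z₀‖ := by
    intro a k
    induction k with
    | zero => simp
    | succ k ih =>
      rw [iterate_succ_apply']
      calc _ = ‖T (T^[k] a) - T z₀‖ := by rw [hz₀]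
        _ ≤ _ := (hstep _ _).trans ih
  obtain ⟨z, -, φ, hφ, hz⟩ := tendsto_subseq_of_bounded
    (Metric.isBounded_closedBall (x := z₀) (r := ‖u - z₀‖))
    (x := fun k => T^[k] u) (fun k => by simpa [dist_eq_norm] using hbdd u k)
  have hanti : Antitone fun k => ‖T^[k + 1] u - T^[k] u‖ := by
    refine antitone_nat_of_succ_le fun k => ?_
    rw [iterate_succ_apply' T (k + 1)]
    nth_rw 2 [iterate_succ_apply' T k]
    exact hstep _ _
  obtain ⟨c, hc⟩ : ∃ c, Tendsto (fun k => ‖T^[k + 1] u - T^[k] u‖) atTop (𝓝 c) :=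
    ⟨_, tendsto_atTop_ciInf hanti ⟨0, by rintro _ ⟨k, rfl⟩; positivity⟩⟩
  -- Increment norms decrease to `c` along the orbit of `u`; by continuity every increment along the
  -- orbit of the limit point `z` has norm exactly `c`.
  have hcz : ∀ j, ‖T^[j + 1] z - T^[j] z‖ = c := by
    intro j
    have hcont : ∀ l, Continuous T^[l] := fun l => hT.continuous.iterate l
    have h1 : Tendsto (fun k => ‖T^[j + 1] (T^[φ k] u) - T^[j] (T^[φ k] u)‖) atTop
        (𝓝 ‖T^[j + 1] z - T^[j] z‖) :=
      ((((hcont (j + 1)).tendsto z).comp hz).sub (((hcont j).tendsto z).comp hz)).norm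
    refine tendsto_nhds_unique h1 ?_
    have h2 := hc.comp ((tendsto_add_atTop_nat j).comp hφ.tendsto_atTop)
    refine h2.congr fun k => ?_
    simp only [comp_apply, ← iterate_add_apply]
    rw [show φ k + j + 1 = j + 1 + φ k by ring, add_comm (φ k) j]
  have hc0 : c = 0 := by
    by_contra hne
    have hcpos : 0 < c := lt_of_le_of_ne (hcz 0 ▸ norm_nonneg _) (Ne.symm hne)
    set Δ : ℕ → ι → ℝ := fun k => T^[k + 1] z - T^[k] z with hΔ
    have hΔT : ∀ k e, T (T^[k + 1] z) e - T (T^[k] z) e = Δ (k + 1) e := fun k e => by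
      simp only [hΔ, Pi.sub_apply, iterate_succ_apply']
    -- An extremal coordinate of the increment `k + 1` is traced back to one in `P` of the increment
    -- `k`.
    have hex : ∀ k, ∃ p ∈ P, |Δ k p| = c := by
      intro k
      have : ∃ e, |Δ (k + 1) e| = c := by
        by_contra! hlt
        have hle : ∀ e, ‖Δ (k + 1) e‖ < c := fun e =>
          lt_of_le_of_ne ((norm_le_pi_norm _ e).trans_eq (hcz (k + 1))) (hlt e)
        exact absurd (hcz (k + 1)) ((pi_norm_lt_iff hcpos).2 hle).ne
      obtain ⟨e, he⟩ := this
      obtain ⟨p, hp, h⟩ := hP (T^[k + 1] z) (T^[k] z) e (by rw [hcz]; exact hcpos)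
        (by rw [hcz, hΔT, he])
      exact ⟨p, hp, by rw [hcz] at h; exact h⟩
    choose p hp hpc using hex
    -- The value `-c` is handled by `hdiag` with the two points exchanged.
    have hback : ∀ q ∈ P, ∀ k, (Δ (k + 1) q = c → Δ k q = c) ∧
        (Δ (k + 1) q = -c → Δ k q = -c) := by
      intro q hq k
      refine ⟨fun h => ?_, fun h => ?_⟩
      · have := hdiag (T^[k + 1] z) (T^[k] z) q hq (by rw [hcz]; exact hcpos)
          (by rw [hcz, hΔT, h])
        rwa [hcz] at this
      · have := hdiag (T^[k] z) (T^[k + 1] z) q hq (by rw [norm_sub_rev, hcz]; exact hcpos)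
          (by rw [norm_sub_rev, hcz, ← neg_sub, hΔT, h, neg_neg])
        rw [norm_sub_rev, hcz, ← neg_sub] at this
        exact neg_eq_iff_eq_neg.1 this
    -- Pigeonhole: one coordinate with one sign is extremal at arbitrarily late times. Since
    -- extremality passes backwards in time, it is then extremal with that sign at all times.
    obtain ⟨⟨q, b⟩, hinf⟩ := Finite.exists_infinite_fiber (fun k => (p k, decide (Δ k (p k) = c)))
    have hinf' := Set.infinite_coe_iff.1 hinf
    have hqP : q ∈ P := by
      obtain ⟨k, hk⟩ := hinf'.nonempty
      have hk' : p k = q := congrArg Prod.fst hk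
      exact hk' ▸ hp k
    have hall : ∃ s : ℝ, |s| = c ∧ ∀ k, Δ k q = s := by
      have key : ∀ s : ℝ, (∀ k, Δ (k + 1) q = s → Δ k q = s) →
          (∀ k, (p k, decide (Δ k (p k) = c)) = (q, b) → Δ k q = s) → ∀ k, Δ k q = s := by
        intro s hs hb k
        obtain ⟨l, hl, hkl⟩ := hinf'.exists_gt k
        have hl' := hb l hl
        clear hl
        obtain ⟨r, rfl⟩ := Nat.exists_eq_add_of_lt hkl
        clear hkl
        have : ∀ r, Δ (k + r) q = s → Δ k q = s := by
          intro r
          induction r with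
          | zero => exact id
          | succ r ih => exact fun h => ih (hs _ h)
        exact this (r + 1) hl'
      cases b with
      | true =>
        refine ⟨c, abs_of_pos hcpos, key c (fun k => (hback q hqP k).1) fun k hk => ?_⟩
        simp only [Prod.mk.injEq, decide_eq_true_eq] at hk
        exact hk.1 ▸ hk.2
      | false =>
        refine ⟨-c, by rw [abs_neg, abs_of_pos hcpos],
          key (-c) (fun k => (hback q hqP k).2) fun k hk => ?_⟩
        simp only [Prod.mk.injEq, decide_eq_false_iff_not] at hk
        rcases (abs_eq hcpos.le).1 (hpc k) with h | h
        · exact absurd h hk.2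
        · exact hk.1 ▸ h
    obtain ⟨s, hs, hsΔ⟩ := hall
    have hlin : ∀ k : ℕ, T^[k] z q = z q + k * s := by
      intro k
      induction k with
      | zero => simp
      | succ k ih =>
        have := hsΔ k
        simp only [hΔ, Pi.sub_apply] at this
        push_cast
        linarith
    obtain ⟨k, hk⟩ := exists_nat_gt ((2 * ‖z - z₀‖) / c)
    rw [div_lt_iff₀ hcpos] at hk
    have h1 := (norm_le_pi_norm (T^[k] z - z₀) q).trans (hbdd z k)
    have h2 := norm_le_pi_norm (z - z₀) q
    simp only [Pi.sub_apply, hlin, Real.norm_eq_abs] at h1 h2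
    have h3 : |(k : ℝ) * s| ≤ |z q + k * s - z₀ q| + |z q - z₀ q| := by
      have := abs_sub (z q + k * s - z₀ q) (z q - z₀ q)
      rwa [show z q + k * s - z₀ q - (z q - z₀ q) = k * s by ring] at this
    rw [abs_mul, hs, Nat.abs_cast] at h3
    linarith
  have hTz : T z = z := by
    have := hcz 0
    rw [hc0, norm_eq_zero, sub_eq_zero] at this
    simpa using this
  refine ⟨z, hTz, ?_⟩
  -- The distance to the fixed point `z` decreases and tends to zero along a subsequence, hence
  -- along the whole orbit.
  have hanti' : Antitone fun k => dist (T^[k] u) z := by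
    refine antitone_nat_of_succ_le fun k => ?_
    rw [iterate_succ_apply']
    simpa [hTz] using hT.dist_le_mul (T^[k] u) z
  rw [tendsto_iff_dist_tendsto_zero] at hz ⊢
  have hlim := tendsto_atTop_ciInf hanti' ⟨0, by rintro _ ⟨k, rfl⟩; positivity⟩
  rwa [tendsto_nhds_unique (hlim.comp hφ.tendsto_atTop) hz] at hlim

/-! ### Entries of an array, transposition -/

/-- The positions of an array: pairs, missed detections, false alarms. -/
abbrev Entry (n m : ℕ) := (Fin n × Fin m) ⊕ (Fin n ⊕ Fin m)

/-- The position in row `i` which is the missed detection (`none`) or a pair (`some j`). -/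
def Entry.row (i : Fin n) (o : Option (Fin m)) : Entry n m :=
  o.elim (Sum.inr (Sum.inl i)) fun j => Sum.inl (i, j)

/-- The position in column `j` which is the false alarm (`none`) or a pair (`some i`). -/
def Entry.col (j : Fin m) (o : Option (Fin n)) : Entry n m :=
  o.elim (Sum.inr (Sum.inr j)) fun i => Sum.inl (i, j)

@[simp] theorem Entry.row_none (i : Fin n) :
    Entry.row i none = (Sum.inr (Sum.inl i) : Entry n m) := rfl
@[simp] theorem Entry.row_some (i : Fin n) (j : Fin m) : Entry.row i (some j) = Sum.inl (i, j) := rfl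
@[simp] theorem Entry.col_none (j : Fin m) :
    Entry.col j none = (Sum.inr (Sum.inr j) : Entry n m) := rfl
@[simp] theorem Entry.col_some (j : Fin m) (i : Fin n) : Entry.col j (some i) = Sum.inl (i, j) := rfl

/-- Transposition of positions. -/
def Entry.swap (e : Entry n m) : Entry m n :=
  e.elim (fun p => Sum.inl (p.2, p.1)) (Sum.elim (fun i => Sum.inr (Sum.inr i))
    fun j => Sum.inr (Sum.inl j))

@[simp] theorem Entry.swap_row (i : Fin n) (o : Option (Fin m)) :
    (Entry.row i o).swap = Entry.col i o := by
  cases o <;> rfl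

@[simp] theorem Entry.swap_col (j : Fin m) (o : Option (Fin n)) :
    (Entry.col j o).swap = Entry.row j o := by
  cases o <;> rfl

/-- An array as a function of its position. -/
def Arr.val (a : Arr n m) : Entry n m → ℝ :=
  Sum.elim (fun p => a.pair p.1 p.2) (Sum.elim a.miss a.fa)

/-- The array with given entries. -/
def Arr.of (f : Entry n m → ℝ) : Arr n m where
  pair i j := f (Sum.inl (i, j))
  miss i := f (Sum.inr (Sum.inl i))
  fa j := f (Sum.inr (Sum.inr j))

@[simp] theorem Arr.val_pair (a : Arr n m) (i : Fin n) (j : Fin m) :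
    a.val (Sum.inl (i, j)) = a.pair i j := rfl
@[simp] theorem Arr.val_miss (a : Arr n m) (i : Fin n) : a.val (Sum.inr (Sum.inl i)) = a.miss i := rfl
@[simp] theorem Arr.val_fa (a : Arr n m) (j : Fin m) : a.val (Sum.inr (Sum.inr j)) = a.fa j := rfl
@[simp] theorem Arr.of_val (a : Arr n m) : Arr.of a.val = a := rfl

@[simp] theorem Arr.val_of (f : Entry n m → ℝ) : (Arr.of f).val = f := by
  ext e
  rcases e with ⟨i, j⟩ | i | j <;> rfl

theorem Arr.val_injective : Injective (Arr.val : Arr n m → Entry n m → ℝ) := fun a b h => by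
  rw [← a.of_val, h, b.of_val]

theorem Arr.forall_val {P : ℝ → Prop} {a : Arr n m} :
    ((∀ i j, P (a.pair i j)) ∧ (∀ i, P (a.miss i)) ∧ ∀ j, P (a.fa j)) ↔ ∀ e, P (a.val e) := by
  simp [Sum.forall]

theorem Arr.nonneg_iff {a : Arr n m} : a.Nonneg ↔ ∀ e, 0 ≤ a.val e := Arr.forall_val

theorem Arr.pos_iff {a : Arr n m} : a.Pos ↔ ∀ e, 0 < a.val e := Arr.forall_val (P := fun t => 0 < t)

theorem Arr.convergesTo_iff {u : ℕ → Arr n m} {a : Arr n m} :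
    Arr.ConvergesTo u a ↔ ∀ e, Tendsto (fun k => (u k).val e) atTop (𝓝 (a.val e)) := by
  simp [Arr.ConvergesTo, Sum.forall]

/-- Exchange of targets and measurements. -/
def Arr.transpose (a : Arr n m) : Arr m n where
  pair j i := a.pair i j
  miss := a.fa
  fa := a.miss

@[simp] theorem Arr.val_transpose (a : Arr n m) (e : Entry m n) :
    a.transpose.val e = a.val e.swap := by
  rcases e with ⟨i, j⟩ | i | j <;> rfl

/-- This symmetry lets each fact about the second half-iteration be read off from the first. -/
theorem stepS_eq_transpose (α β γ : ℝ) (w x : Arr n m) :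
    stepS α β γ w x = (stepR β α γ w.transpose x.transpose).transpose := by
  ext <;> simp [stepS, stepR, Arr.transpose, add_comm α β]

/-- Every row and every column has at least two entries of positive weight. -/
structure Nondegenerate (w : Arr n m) : Prop where
  nonneg : ∀ e, 0 ≤ w.val e
  row : ∀ i o, ∃ o' ≠ o, 0 < w.val (Entry.row i o')
  col : ∀ j o, ∃ o' ≠ o, 0 < w.val (Entry.col j o')

theorem Nondegenerate.transpose {w : Arr n m} (hw : Nondegenerate w) :
    Nondegenerate w.transpose where
  nonneg e := by simpa using hw.nonneg e.swap
  row i o := by simpa using hw.col i o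
  col j o := by simpa using hw.row j o

/-! ### Logarithms of weighted sums of exponentials -/

/-- The logarithm of a weighted sum of exponentials. -/
noncomputable def logSumExp {ι : Type*} (s : Finset ι) (w u : ι → ℝ) : ℝ :=
  Real.log (∑ e ∈ s, w e * Real.exp (u e))

section logSumExp
variable {ι : Type*} {s : Finset ι} {w u v : ι → ℝ} {c : ℝ}

theorem sum_mul_exp_pos (hw : ∀ e, 0 ≤ w e) (hs : ∃ e ∈ s, 0 < w e) (u : ι → ℝ) :
    0 < ∑ e ∈ s, w e * Real.exp (u e) :=
  let ⟨e, he, hwe⟩ := hs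
  Finset.sum_pos' (fun e _ => mul_nonneg (hw e) (Real.exp_pos _).le)
    ⟨e, he, mul_pos hwe (Real.exp_pos _)⟩

/-- Log-sum-exp is monotone and commutes with adding a constant to all arguments. -/
theorem logSumExp_sub_le (hw : ∀ e, 0 ≤ w e) (hs : ∃ e ∈ s, 0 < w e) (h : ∀ e, u e - v e ≤ c) :
    logSumExp s w u - logSumExp s w v ≤ c := by
  have hv := sum_mul_exp_pos hw hs v
  rw [sub_le_iff_le_add, logSumExp, logSumExp,
    Real.log_le_iff_le_exp (sum_mul_exp_pos hw hs u), Real.exp_add, Real.exp_log hv,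
    Finset.mul_sum]
  refine Finset.sum_le_sum fun e _ => ?_
  rw [mul_left_comm, ← Real.exp_add]
  exact mul_le_mul_of_nonneg_left (Real.exp_le_exp.2 (by linarith [h e])) (hw e)

theorem abs_logSumExp_sub_le (hw : ∀ e, 0 ≤ w e) (hs : ∃ e ∈ s, 0 < w e)
    (h : ∀ e, |u e - v e| ≤ c) : |logSumExp s w u - logSumExp s w v| ≤ c := by
  refine abs_le.2 ⟨?_, logSumExp_sub_le hw hs fun e => (le_abs_self _).trans (h e)⟩
  have := logSumExp_sub_le (u := v) (v := u) (c := c) hw hs fun e =>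
    (le_abs_self _).trans ((abs_sub_comm _ _).trans_le (h e))
  linarith

/-- Equality in a termwise inequality between sums forces equality in each term; the terms of
positive weight determine the exponents. -/
theorem eq_of_logSumExp_sub_eq (hw : ∀ e, 0 ≤ w e) (hs : ∃ e ∈ s, 0 < w e)
    (h : ∀ e, u e - v e ≤ c) (heq : logSumExp s w u - logSumExp s w v = c) {e : ι} (he : e ∈ s)
    (hwe : 0 < w e) : u e - v e = c := by
  have hv := sum_mul_exp_pos hw hs v
  rw [sub_eq_iff_eq_add, logSumExp, logSumExp] at heq
  have hsum : ∑ e ∈ s, w e * Real.exp (u e) = ∑ e ∈ s, w e * Real.exp (c + v e) := by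
    rw [← Real.exp_log (sum_mul_exp_pos hw hs u), heq, Real.exp_add, Real.exp_log hv,
      Finset.mul_sum]
    exact Finset.sum_congr rfl fun e _ => by rw [mul_left_comm, ← Real.exp_add]
  rw [Finset.sum_eq_sum_iff_of_le fun e _ =>
    mul_le_mul_of_nonneg_left (Real.exp_le_exp.2 (by linarith [h e])) (hw e)] at hsum
  have := Real.exp_injective (mul_left_cancel₀ hwe.ne' (hsum e he))
  linarith

end logSumExp

/-! ### The half-iterations in logarithmic coordinates -/

/-- The first half-iteration acting on the logarithms of the messages. -/
noncomputable def logStepR (α β γ : ℝ) (w : Arr n m) (u : Entry n m → ℝ) : Entry n m → ℝ :=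
  Sum.elim
    (fun p => (α + β - 1 - γ)
      - (1 - γ) * logSumExp Finset.univ (w.val ∘ Entry.col p.2) (u ∘ Entry.col p.2)
      - γ * logSumExp (Finset.univ.erase (some p.1)) (w.val ∘ Entry.col p.2) (u ∘ Entry.col p.2))
    (Sum.elim (fun i => (1 / α - 1) * u (Sum.inr (Sum.inl i)))
      fun j => -logSumExp Finset.univ (w.val ∘ Entry.col j) (u ∘ Entry.col j))

/-- The second half-iteration acting on the logarithms of the messages. -/
noncomputable def logStepS (α β γ : ℝ) (w : Arr n m) (u : Entry n m → ℝ) : Entry n m → ℝ :=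
  logStepR β α γ w.transpose (u ∘ Entry.swap) ∘ Entry.swap

theorem sum_erase_some {ι : Type*} [Fintype ι] [DecidableEq ι] (f : Option ι → ℝ) (i : ι) :
    ∑ o ∈ Finset.univ.erase (some i), f o = f none + ∑ i' ∈ Finset.univ.erase i, f (some i') := by
  rw [Finset.sum_erase_eq_sub (Finset.mem_univ _), Finset.sum_erase_eq_sub (Finset.mem_univ _),
    Fintype.sum_option]
  ring

theorem Nondegenerate.nonneg_col {w : Arr n m} (hw : Nondegenerate w) (j : Fin m)
    (o : Option (Fin n)) : 0 ≤ (w.val ∘ Entry.col j) o := hw.nonneg _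

theorem Nondegenerate.exists_col {w : Arr n m} (hw : Nondegenerate w) (j : Fin m) :
    ∃ o ∈ (Finset.univ : Finset (Option (Fin n))), 0 < (w.val ∘ Entry.col j) o :=
  let ⟨o, _, h⟩ := hw.col j none
  ⟨o, Finset.mem_univ o, h⟩

theorem Nondegenerate.exists_col_erase {w : Arr n m} (hw : Nondegenerate w) (j : Fin m)
    (i : Fin n) :
    ∃ o ∈ (Finset.univ : Finset (Option (Fin n))).erase (some i), 0 < (w.val ∘ Entry.col j) o :=
  let ⟨o, ho, h⟩ := hw.col j (some i)
  ⟨o, Finset.mem_erase.2 ⟨ho, Finset.mem_univ o⟩, h⟩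

/-- Nondegeneracy keeps all the sums positive, even with one entry erased, so that they are
exponentials of their logarithms. -/
theorem stepR_exp (α β γ : ℝ) {w : Arr n m} (hw : Nondegenerate w) (u : Entry n m → ℝ) :
    stepR α β γ w (Arr.of (Real.exp ∘ u)) = Arr.of (Real.exp ∘ logStepR α β γ w u) := by
  have h1 : ∀ j, Real.exp (logSumExp Finset.univ (w.val ∘ Entry.col j) (u ∘ Entry.col j)) =
      w.fa j * Real.exp (u (Sum.inr (Sum.inr j))) +
        ∑ i, w.pair i j * Real.exp (u (Sum.inl (i, j))) := by
    intro j
    rw [logSumExp, Real.exp_log (sum_mul_exp_pos (hw.nonneg_col j) (hw.exists_col j) _),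
      Fintype.sum_option]
    simp
  have h2 : ∀ j i, Real.exp (logSumExp (Finset.univ.erase (some i)) (w.val ∘ Entry.col j)
      (u ∘ Entry.col j)) = w.fa j * Real.exp (u (Sum.inr (Sum.inr j))) +
        ∑ i' ∈ Finset.univ.erase i, w.pair i' j * Real.exp (u (Sum.inl (i', j))) := by
    intro j i
    rw [logSumExp, Real.exp_log (sum_mul_exp_pos (hw.nonneg_col j)
      (hw.exists_col_erase j i) _), sum_erase_some]
    simp
  ext
  · simp only [stepR, Arr.of, comp_apply, logStepR, Sum.elim_inl, ← h1, ← h2, ← Real.exp_mul,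
      ← Real.exp_add]
    congr 1
    ring
  · simp only [stepR, Arr.of, comp_apply, logStepR, Sum.elim_inl, Sum.elim_inr, ← Real.exp_mul]
    rw [mul_comm]
  · simp only [stepR, Arr.of, comp_apply, logStepR, Sum.elim_inr, ← h1, Real.exp_neg]

theorem stepS_exp (α β γ : ℝ) {w : Arr n m} (hw : Nondegenerate w) (u : Entry n m → ℝ) :
    stepS α β γ w (Arr.of (Real.exp ∘ u)) = Arr.of (Real.exp ∘ logStepS α β γ w u) := by
  rw [stepS_eq_transpose, show (Arr.of (Real.exp ∘ u)).transpose =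
    Arr.of (Real.exp ∘ u ∘ Entry.swap) from rfl, stepR_exp _ _ _ hw.transpose]
  rfl

section nonexpansive
variable {α β γ c : ℝ} {w : Arr n m} {u v : Entry n m → ℝ}

/-- The source of the threshold 1/2: the exponent of the copied message is a strict contraction
factor in logarithmic coordinates. -/
theorem abs_one_div_sub_one_lt (hα : 1 / 2 < α) : |1 / α - 1| < 1 := by
  have h0 : 0 < α := by linarith
  have h1 : 0 < 1 / α := by positivity
  have h2 : 1 / α < 2 := by rw [div_lt_iff₀ h0]; linarith
  exact abs_lt.2 ⟨by linarith, by linarith⟩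

theorem abs_logStepR_sub_miss_lt (hα : 1 / 2 < α) (hc : 0 < c) (h : ∀ e, |u e - v e| ≤ c)
    (i : Fin n) :
    |logStepR α β γ w u (Sum.inr (Sum.inl i)) - logStepR α β γ w v (Sum.inr (Sum.inl i))| < c := by
  simp only [logStepR, Sum.elim_inr, Sum.elim_inl, ← mul_sub, abs_mul]
  calc _ ≤ |1 / α - 1| * c := mul_le_mul_of_nonneg_left (h _) (abs_nonneg _)
    _ < 1 * c := mul_lt_mul_of_pos_right (abs_one_div_sub_one_lt hα) hc
    _ = c := one_mul c

/-- On pairs, the update is minus a convex combination, with weights `1 - γ` and `γ`, of two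
nonexpansive functions, up to a constant. -/
theorem abs_logStepR_sub_le (hα : 1 / 2 < α) (hγ₀ : 0 ≤ γ) (hγ₁ : γ < 1) (hw : Nondegenerate w)
    (h : ∀ e, |u e - v e| ≤ c) (e : Entry n m) :
    |logStepR α β γ w u e - logStepR α β γ w v e| ≤ c := by
  rcases e with ⟨i, j⟩ | i | j
  · have h1 := abs_le.1 (abs_logSumExp_sub_le (u := u ∘ Entry.col j) (v := v ∘ Entry.col j)
      (hw.nonneg_col j) (hw.exists_col j) fun o => h _)
    have h2 := abs_le.1 (abs_logSumExp_sub_le (u := u ∘ Entry.col j) (v := v ∘ Entry.col j)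
      (hw.nonneg_col j) (hw.exists_col_erase j i) fun o => h _)
    simp only [logStepR, Sum.elim_inl]
    rw [abs_le]
    constructor <;> nlinarith [mul_le_mul_of_nonneg_left h1.1 (sub_nonneg.2 hγ₁.le),
      mul_le_mul_of_nonneg_left h1.2 (sub_nonneg.2 hγ₁.le),
      mul_le_mul_of_nonneg_left h2.1 hγ₀, mul_le_mul_of_nonneg_left h2.2 hγ₀]
  · rcases ((abs_nonneg _).trans (h (Sum.inr (Sum.inl i)))).eq_or_lt with hc | hc
    · have := h (Sum.inr (Sum.inl i))
      rw [← hc, abs_nonpos_iff, sub_eq_zero] at this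
      simp [logStepR, this, ← hc]
    · exact (abs_logStepR_sub_miss_lt hα hc h i).le
  · have h1 := abs_logSumExp_sub_le (u := u ∘ Entry.col j) (v := v ∘ Entry.col j)
      (hw.nonneg_col j) (hw.exists_col j) fun o => h _
    simp only [logStepR, Sum.elim_inr]
    rwa [neg_sub_neg, abs_sub_comm]

theorem sub_eq_neg_of_logSumExp (hw : Nondegenerate w)
    (h : ∀ e, |u e - v e| ≤ c) {j : Fin m}
    (heq : logSumExp Finset.univ (w.val ∘ Entry.col j) (u ∘ Entry.col j) -
      logSumExp Finset.univ (w.val ∘ Entry.col j) (v ∘ Entry.col j) = -c) (o : Option (Fin n))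
    (ho : 0 < w.val (Entry.col j o)) : u (Entry.col j o) - v (Entry.col j o) = -c := by
  have := eq_of_logSumExp_sub_eq (u := v ∘ Entry.col j) (v := u ∘ Entry.col j) (c := c)
    (w := w.val ∘ Entry.col j) (hw.nonneg_col j) (hw.exists_col j)
    (fun o => (le_abs_self _).trans ((abs_sub_comm _ _).trans_le (h _))) (by linarith)
    (Finset.mem_univ o) ho
  simp only [comp_apply] at this
  linarith

/-- Since `1 - γ > 0`, an extremal difference of the convex combination is extremal for the sum over
the full column, which then passes it to every weighted entry with the sign reversed. -/
theorem sub_eq_neg_of_logStepR_pair (hγ₀ : 0 ≤ γ) (hγ₁ : γ < 1) (hw : Nondegenerate w)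
    (h : ∀ e, |u e - v e| ≤ c) {i : Fin n} {j : Fin m}
    (heq : logStepR α β γ w u (Sum.inl (i, j)) - logStepR α β γ w v (Sum.inl (i, j)) = c)
    (o : Option (Fin n)) (ho : 0 < w.val (Entry.col j o)) :
    u (Entry.col j o) - v (Entry.col j o) = -c := by
  refine sub_eq_neg_of_logSumExp hw h ?_ o ho
  have h1 := abs_le.1 (abs_logSumExp_sub_le (u := u ∘ Entry.col j) (v := v ∘ Entry.col j)
    (hw.nonneg_col j) (hw.exists_col j) fun o => h _)
  have h2 := abs_le.1 (abs_logSumExp_sub_le (u := u ∘ Entry.col j) (v := v ∘ Entry.col j)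
    (hw.nonneg_col j) (hw.exists_col_erase j i) fun o => h _)
  simp only [logStepR, Sum.elim_inl] at heq
  refine le_antisymm ?_ h1.1
  have h3 := mul_le_mul_of_nonneg_left h2.1 hγ₀
  refine le_of_mul_le_mul_left ?_ (sub_pos.2 hγ₁)
  linarith

theorem sub_eq_neg_of_logStepR_fa (hw : Nondegenerate w)
    (h : ∀ e, |u e - v e| ≤ c) {j : Fin m}
    (heq : logStepR α β γ w u (Sum.inr (Sum.inr j)) - logStepR α β γ w v (Sum.inr (Sum.inr j)) = c)
    (o : Option (Fin n)) (ho : 0 < w.val (Entry.col j o)) :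
    u (Entry.col j o) - v (Entry.col j o) = -c := by
  refine sub_eq_neg_of_logSumExp hw h ?_ o ho
  simp only [logStepR, Sum.elim_inr] at heq
  linarith

theorem abs_logStepS_sub_fa_lt (hβ : 1 / 2 < β) (hc : 0 < c) (h : ∀ e, |u e - v e| ≤ c)
    (j : Fin m) :
    |logStepS α β γ w u (Sum.inr (Sum.inr j)) - logStepS α β γ w v (Sum.inr (Sum.inr j))| < c :=
  abs_logStepR_sub_miss_lt (β := α) (γ := γ) (w := w.transpose) (u := u ∘ Entry.swap) (v := v ∘ Entry.swap) hβ hc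
    (fun e => h e.swap) j

theorem abs_logStepS_sub_le (hβ : 1 / 2 < β) (hγ₀ : 0 ≤ γ) (hγ₁ : γ < 1) (hw : Nondegenerate w)
    (h : ∀ e, |u e - v e| ≤ c) (e : Entry n m) :
    |logStepS α β γ w u e - logStepS α β γ w v e| ≤ c :=
  abs_logStepR_sub_le (u := u ∘ Entry.swap) (v := v ∘ Entry.swap) hβ hγ₀ hγ₁ hw.transpose
    (fun e => h e.swap) e.swap

theorem sub_eq_neg_of_logStepS_pair (hγ₀ : 0 ≤ γ) (hγ₁ : γ < 1) (hw : Nondegenerate w)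
    (h : ∀ e, |u e - v e| ≤ c) {i : Fin n} {j : Fin m}
    (heq : logStepS α β γ w u (Sum.inl (i, j)) - logStepS α β γ w v (Sum.inl (i, j)) = c)
    (o : Option (Fin m)) (ho : 0 < w.val (Entry.row i o)) :
    u (Entry.row i o) - v (Entry.row i o) = -c := by
  have := sub_eq_neg_of_logStepR_pair (u := u ∘ Entry.swap) (v := v ∘ Entry.swap) hγ₀ hγ₁
    hw.transpose (fun e => h e.swap) heq o (by simpa using ho)
  simpa using this

theorem sub_eq_neg_of_logStepS_miss (hw : Nondegenerate w)
    (h : ∀ e, |u e - v e| ≤ c) {i : Fin n}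
    (heq : logStepS α β γ w u (Sum.inr (Sum.inl i)) - logStepS α β γ w v (Sum.inr (Sum.inl i)) = c)
    (o : Option (Fin m)) (ho : 0 < w.val (Entry.row i o)) :
    u (Entry.row i o) - v (Entry.row i o) = -c := by
  have := sub_eq_neg_of_logStepR_fa (α := β) (β := α) (γ := γ) (u := u ∘ Entry.swap) (v := v ∘ Entry.swap)
    hw.transpose (fun e => h e.swap) heq o (by simpa using ho)
  simpa using this

end nonexpansive

/-- A full iteration acting on the logarithms of the messages. -/
noncomputable def logIter (α β γ : ℝ) (w : Arr n m) (u : Entry n m → ℝ) : Entry n m → ℝ :=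
  logStepS α β γ w (logStepR α β γ w u)

/-- Two sign reversals, one per half-iteration, restore the sign: a full difference at a pair after
the iteration comes from the whole row of `x`, hence from the whole column of `y`, which contains
the same pair. -/
theorem exists_tendsto_logIter {α β γ : ℝ} {w : Arr n m} (hα : 1 / 2 < α) (hβ : 1 / 2 < β)
    (hγ₀ : 0 ≤ γ) (hγ₁ : γ < 1) (hw : Nondegenerate w) (hfix : ∃ z, logIter α β γ w z = z)
    (u : Entry n m → ℝ) :
    ∃ z, logIter α β γ w z = z ∧ Tendsto (fun k => (logIter α β γ w)^[k] u) atTop (𝓝 z) := by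
  have hle : ∀ (u v : Entry n m → ℝ) e, |u e - v e| ≤ ‖u - v‖ := fun u v e =>
    norm_le_pi_norm (u - v) e
  have hR : ∀ u v : Entry n m → ℝ, ∀ e,
      |logStepR α β γ w u e - logStepR α β γ w v e| ≤ ‖u - v‖ := fun u v e =>
    abs_logStepR_sub_le hα hγ₀ hγ₁ hw (hle u v) e
  have hdiag : ∀ u v : Entry n m → ℝ, ∀ i j, 0 < w.pair i j →
      logStepR α β γ w u (Sum.inl (i, j)) - logStepR α β γ w v (Sum.inl (i, j)) = -‖u - v‖ →
      u (Sum.inl (i, j)) - v (Sum.inl (i, j)) = ‖u - v‖ := by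
    intro u v i j hij h
    have := sub_eq_neg_of_logStepR_pair (u := v) (v := u) hγ₀ hγ₁ hw
      (fun e => (abs_sub_comm _ _).trans_le (hle u v e)) (i := i) (j := j)
      (by linarith) (some i) hij
    simp only [Entry.col_some] at this
    linarith
  refine exists_tendsto_iterate_of_nonexpansive (logIter α β γ w)
    {e | ∃ i j, e = Sum.inl (i, j) ∧ 0 < w.pair i j} ?_ ?_ ?_ hfix u
  · refine LipschitzWith.of_dist_le_mul fun u v => ?_
    rw [NNReal.coe_one, one_mul, dist_eq_norm, dist_eq_norm, pi_norm_le_iff_of_nonneg (norm_nonneg _)]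
    exact fun e => abs_logStepS_sub_le hβ hγ₀ hγ₁ hw (hR u v) e
  · have key : ∀ u v e, 0 < ‖u - v‖ → logIter α β γ w u e - logIter α β γ w v e = ‖u - v‖ →
        ∃ p ∈ {e : Entry n m | ∃ i j, e = Sum.inl (i, j) ∧ 0 < w.pair i j},
          u p - v p = ‖u - v‖ := by
      intro u v e hpos h
      have hrow : ∀ i, (∀ o, 0 < w.val (Entry.row i o) →
          logStepR α β γ w u (Entry.row i o) - logStepR α β γ w v (Entry.row i o) = -‖u - v‖) →
          ∃ p ∈ {e : Entry n m | ∃ i j, e = Sum.inl (i, j) ∧ 0 < w.pair i j},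
            u p - v p = ‖u - v‖ := by
        intro i hi
        -- Excluding `none` yields a genuine pair of positive weight in row `i`.
        obtain ⟨o, ho, hpo⟩ := hw.row i none
        obtain ⟨j, rfl⟩ := Option.ne_none_iff_exists'.1 ho
        exact ⟨_, ⟨i, j, rfl, hpo⟩, hdiag u v i j hpo (hi _ hpo)⟩
      rcases e with ⟨i, j⟩ | i | j
      · exact hrow i (sub_eq_neg_of_logStepS_pair hγ₀ hγ₁ hw (hR u v) h)
      · exact hrow i (sub_eq_neg_of_logStepS_miss hw (hR u v) h)
      · exact absurd ((le_abs_self _).trans_lt (abs_logStepS_sub_fa_lt hβ hpos (hR u v) j)) h.not_lt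
    intro u v e hpos h
    rcases (abs_eq hpos.le).1 h with h | h
    · obtain ⟨p, hp, hpe⟩ := key u v e hpos h
      exact ⟨p, hp, by rw [hpe, abs_norm]⟩
    · obtain ⟨p, hp, hpe⟩ := key v u e (by rwa [norm_sub_rev])
        (by rw [norm_sub_rev]; linarith)
      exact ⟨p, hp, by rw [abs_sub_comm, hpe, abs_norm, norm_sub_rev]⟩
  · rintro u v _ ⟨i, j, rfl, hij⟩ hpos h
    exact hdiag u v i j hij (sub_eq_neg_of_logStepS_pair hγ₀ hγ₁ hw (hR u v) h (some j) hij)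

/-! ### The quadratic inequality behind convexity -/

/-- On the simplex the form `∑ d ^ 2 / q` dominates `∑ d ^ 2 / (1 - q)` in directions of zero sum. -/
theorem sum_sq_div_one_sub_le {ι : Type*} [Fintype ι] [DecidableEq ι] {q d : ι → ℝ}
    (hq : ∀ e, 0 ≤ q e) (hq1 : ∑ e, q e = 1) (hlt : ∀ e, q e < 1) (hd : ∑ e, d e = 0)
    (hz : ∀ e, q e = 0 → d e = 0) :
    ∑ e, d e ^ 2 / (1 - q e) ≤ ∑ e, d e ^ 2 / q e := by
  -- If all `q e ≤ 1/2` the inequality is termwise. Otherwise a single entry `a` exceeds 1/2, and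
  -- the excess of its term is absorbed by the others.
  by_cases hhalf : ∀ e, q e ≤ 1 / 2
  · refine Finset.sum_le_sum fun e _ => ?_
    rcases (hq e).eq_or_lt with h | h
    · simp [hz e h.symm]
    · exact div_le_div_of_nonneg_left (sq_nonneg _) h (by linarith [hhalf e])
  push Not at hhalf
  obtain ⟨a, ha⟩ := hhalf
  set s := 1 - q a with hs
  have hs0 : 0 < s := sub_pos.2 (hlt a)
  have hs1 : 0 < 1 - s := by linarith
  have hsum : ∑ e ∈ Finset.univ.erase a, q e = s := by
    rw [Finset.sum_erase_eq_sub (Finset.mem_univ a), hq1]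
  have hdsum : ∑ e ∈ Finset.univ.erase a, d e = -d a := by
    rw [Finset.sum_erase_eq_sub (Finset.mem_univ a), hd, zero_sub]
  set Q := ∑ e ∈ Finset.univ.erase a, d e ^ 2 / q e with hQ
  -- Cauchy–Schwarz on the other entries, whose `d` sum to `-d a` and whose `q` sum to `s < 1/2`.
  have hcs : d a ^ 2 ≤ Q * s := by
    have := Finset.sum_sq_le_sum_mul_sum_of_sq_le_mul (Finset.univ.erase a) (r := d)
      (f := fun e => d e ^ 2 / q e) (g := q) (fun e _ => div_nonneg (sq_nonneg _) (hq e))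
      (fun e _ => hq e) (fun e _ => by
        by_cases h : q e = 0
        · simp [h, hz e h]
        · rw [div_mul_cancel₀ _ h])
    rwa [hdsum, hsum, neg_sq] at this
  -- As `q e ≤ s`, one has `1 / (1 - q e) ≤ (s / (1 - s)) / q e` where `q e > 0`.
  have hother : ∑ e ∈ Finset.univ.erase a, d e ^ 2 / (1 - q e) ≤ Q * (s / (1 - s)) := by
    rw [hQ, Finset.sum_mul]
    refine Finset.sum_le_sum fun e he => ?_
    have hes : q e ≤ s := hsum ▸ Finset.single_le_sum (f := q) (fun e _ => hq e) he
    rcases (hq e).eq_or_lt with h | h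
    · simp [hz e h.symm]
    · rw [div_mul_div_comm, div_le_div_iff₀ (by linarith [hlt e]) (mul_pos h hs1)]
      nlinarith [mul_nonneg (sq_nonneg (d e)) (sub_nonneg.2 hes)]
  rw [← Finset.add_sum_erase _ _ (Finset.mem_univ a),
    ← Finset.add_sum_erase (a := a) _ (fun e => d e ^ 2 / q e) (Finset.mem_univ a),
    ← hQ, ← hs, show q a = 1 - s by ring]
  have hfac : 0 ≤ (1 - 2 * s) / (s * (1 - s)) :=
    div_nonneg (by linarith) (mul_pos hs0 hs1).le
  have h := mul_le_mul_of_nonneg_right hcs hfac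
  have e1 : d a ^ 2 * ((1 - 2 * s) / (s * (1 - s))) = d a ^ 2 / s - d a ^ 2 / (1 - s) := by
    field_simp
    ring
  have e2 : Q * s * ((1 - 2 * s) / (s * (1 - s))) = Q - Q * (s / (1 - s)) := by
    field_simp
    ring
  linarith

/-! ### The free energy as a function on positions -/

/-- The constraints, for a function on the positions. -/
structure FeasibleFn (w : Arr n m) (f : Entry n m → ℝ) : Prop where
  nonneg : ∀ e, 0 ≤ f e
  row : ∀ i, ∑ o, f (Entry.row i o) = 1
  col : ∀ j, ∑ o, f (Entry.col j o) = 1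
  zero : ∀ e, w.val e = 0 → f e = 0

/-- Directions within the affine hull of the feasible set. -/
structure Tangent (w : Arr n m) (d : Entry n m → ℝ) : Prop where
  row : ∀ i, ∑ o, d (Entry.row i o) = 0
  col : ∀ j, ∑ o, d (Entry.col j o) = 0
  zero : ∀ e, w.val e = 0 → d e = 0

/-- Every entry of positive weight lies strictly between `0` and `1`. -/
def IsInner (w : Arr n m) (f : Entry n m → ℝ) : Prop :=
  ∀ e, 0 < w.val e → f e ∈ Set.Ioo (0 : ℝ) 1

theorem feasible_iff {w q : Arr n m} : Feasible w q ↔ FeasibleFn w q.val := by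
  constructor
  · intro h
    refine ⟨Arr.nonneg_iff.1 h.nonneg, fun i => ?_, fun j => ?_, ?_⟩
    · simpa [Fintype.sum_option] using h.row_sum i
    · simpa [Fintype.sum_option] using h.col_sum j
    · rintro (⟨i, j⟩ | i | j)
      exacts [h.pair_zero i j, h.miss_zero i, h.fa_zero j]
  · intro h
    refine ⟨Arr.nonneg_iff.2 h.nonneg, fun i => ?_, fun j => ?_, fun i j => h.zero (Sum.inl (i, j)),
      fun i => h.zero (Sum.inr (Sum.inl i)), fun j => h.zero (Sum.inr (Sum.inr j))⟩
    · simpa [Fintype.sum_option] using h.row i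
    · simpa [Fintype.sum_option] using h.col j

theorem interiorFeasible_iff {w q : Arr n m} :
    InteriorFeasible w q ↔ FeasibleFn w q.val ∧ IsInner w q.val := by
  constructor
  · intro h
    refine ⟨feasible_iff.1 h.feasible, ?_⟩
    rintro (⟨i, j⟩ | i | j)
    exacts [h.pair_mem i j, h.miss_mem i, h.fa_mem j]
  · rintro ⟨h, h'⟩
    exact ⟨feasible_iff.2 h, fun i j => h' (Sum.inl (i, j)), fun i => h' (Sum.inr (Sum.inl i)),
      fun j => h' (Sum.inr (Sum.inr j))⟩

/-- The coefficients of the entropy terms. -/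
def entropyCoeff (α β : ℝ) : Entry n m → ℝ :=
  Sum.elim (fun _ => 1) (Sum.elim (fun _ => α) fun _ => β)

/-- The coefficients of the fractional terms. -/
def fracCoeff (γ : ℝ) : Entry n m → ℝ := Sum.elim (fun _ => γ) fun _ => 0

/-- A continuous extension of the free energy. -/
noncomputable def energy (α β γ : ℝ) (w : Arr n m) (f : Entry n m → ℝ) : ℝ :=
  ∑ e, (entropyCoeff α β e * (f e * Real.log (f e) - f e * Real.log (w.val e))
    - fracCoeff γ e * ((1 - f e) * Real.log (1 - f e)))

/-- The partial derivatives of the free energy. -/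
noncomputable def grad (α β γ : ℝ) (w : Arr n m) (f : Entry n m → ℝ) (e : Entry n m) : ℝ :=
  entropyCoeff α β e * (Real.log (f e) + 1 - Real.log (w.val e))
    + fracCoeff γ e * (Real.log (1 - f e) + 1)

/-- The second derivative of the free energy. -/
noncomputable def hess (α β γ : ℝ) (f d : Entry n m → ℝ) : ℝ :=
  ∑ e, d e * (entropyCoeff α β e * (d e / f e) - fracCoeff γ e * (d e / (1 - f e)))

/-- The split logarithm makes the energy continuous everywhere; it agrees with the quotient form
because zero weight forces a zero entry. -/
theorem freeEnergy_eq_energy (α β γ : ℝ) {w q : Arr n m} (hz : ∀ e, w.val e = 0 → q.val e = 0) :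
    freeEnergy α β γ w q = energy α β γ w q.val := by
  have key : ∀ e, q.val e * Real.log (q.val e / w.val e) =
      q.val e * Real.log (q.val e) - q.val e * Real.log (w.val e) := by
    intro e
    by_cases hq : q.val e = 0
    · simp [hq]
    · rw [Real.log_div hq (mt (hz e) hq), mul_sub]
  have h1 := fun i j => key (Sum.inl (i, j))
  have h2 := fun i => key (Sum.inr (Sum.inl i))
  have h3 := fun j => key (Sum.inr (Sum.inr j))
  simp only [Arr.val_pair, Arr.val_miss, Arr.val_fa] at h1 h2 h3
  simp only [freeEnergy, energy, Fintype.sum_sum_type, Fintype.sum_prod_type, entropyCoeff,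
    fracCoeff, Sum.elim_inl, Sum.elim_inr, Arr.val_pair, Arr.val_miss, Arr.val_fa, h1, h2, h3,
    Finset.mul_sum, Finset.sum_sub_distrib, one_mul, zero_mul, Finset.sum_const_zero, mul_sub]
  ring

theorem FeasibleFn.le_one {w : Arr n m} {f : Entry n m → ℝ} (h : FeasibleFn w f) (e : Entry n m) :
    f e ≤ 1 := by
  have hr : ∀ i o, f (Entry.row i o) ≤ 1 := fun i o => h.row i ▸
    Finset.single_le_sum (f := fun o => f (Entry.row i o)) (fun o _ => h.nonneg _)
      (Finset.mem_univ o)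
  have hc : ∀ j o, f (Entry.col j o) ≤ 1 := fun j o => h.col j ▸
    Finset.single_le_sum (f := fun o => f (Entry.col j o)) (fun o _ => h.nonneg _)
      (Finset.mem_univ o)
  rcases e with ⟨i, j⟩ | i | j
  exacts [hr i (some j), hr i none, hc j none]

theorem IsInner.lt_one {w : Arr n m} {f : Entry n m → ℝ} (hw : ∀ e, 0 ≤ w.val e)
    (hf : FeasibleFn w f) (h : IsInner w f) (e : Entry n m) : f e < 1 := by
  rcases (hw e).eq_or_lt with h0 | h0
  · rw [hf.zero e h0.symm]
    exact one_pos
  · exact (h e h0).2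

theorem exists_ne_pos_of_sum_eq_one {ι : Type*} [Fintype ι] {f : ι → ℝ} (hf : ∑ e, f e = 1) {a : ι}
    (ha : f a < 1) : ∃ e ≠ a, 0 < f e := by
  classical
  by_contra! h
  rw [← Finset.add_sum_erase _ _ (Finset.mem_univ a)] at hf
  have := Finset.sum_nonpos (s := Finset.univ.erase a) (f := f)
    fun e he => h e (Finset.ne_of_mem_erase he)
  linarith

/-- No entry of an inner point reaches 1, so each row and column sum needs a second positive entry,
necessarily of positive weight. -/
theorem IsInner.nondegenerate {w : Arr n m} {f : Entry n m → ℝ} (hw : ∀ e, 0 ≤ w.val e)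
    (hf : FeasibleFn w f) (h : IsInner w f) : Nondegenerate w := by
  have hpos : ∀ e, 0 < f e → 0 < w.val e := fun e he =>
    (hw e).lt_of_ne fun h0 => he.ne' (hf.zero e h0.symm)
  refine ⟨hw, fun i o => ?_, fun j o => ?_⟩
  · obtain ⟨o', ho', hfo⟩ := exists_ne_pos_of_sum_eq_one (hf.row i) (h.lt_one hw hf _)
    exact ⟨o', ho', hpos _ hfo⟩
  · obtain ⟨o', ho', hfo⟩ := exists_ne_pos_of_sum_eq_one (hf.col j) (h.lt_one hw hf _)
    exact ⟨o', ho', hpos _ hfo⟩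

theorem FeasibleFn.tangent_sub {w : Arr n m} {f g : Entry n m → ℝ} (hf : FeasibleFn w f)
    (hg : FeasibleFn w g) : Tangent w (g - f) where
  row i := by simp [hf.row i, hg.row i]
  col j := by simp [hf.col j, hg.col j]
  zero e he := by simp [hf.zero e he, hg.zero e he]

theorem FeasibleFn.add_smul {w : Arr n m} {f d : Entry n m → ℝ} (hf : FeasibleFn w f)
    (hd : Tangent w d) {t : ℝ} (hnn : ∀ e, 0 ≤ (f + t • d) e) : FeasibleFn w (f + t • d) where
  nonneg := hnn
  row i := by simp [Finset.sum_add_distrib, ← Finset.mul_sum, hf.row i, hd.row i]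
  col j := by simp [Finset.sum_add_distrib, ← Finset.mul_sum, hf.col j, hd.col j]
  zero e he := by simp [hf.zero e he, hd.zero e he]

/-- The half-open segment from a feasible point to an inner feasible point consists of inner
feasible points. -/
theorem FeasibleFn.segment {w : Arr n m} {f g : Entry n m → ℝ} (hf : FeasibleFn w f)
    (hg : FeasibleFn w g) (hgi : IsInner w g) {t : ℝ} (ht₀ : 0 < t) (ht₁ : t ≤ 1) :
    FeasibleFn w (f + t • (g - f)) ∧ IsInner w (f + t • (g - f)) := by
  have hval : ∀ e, (f + t • (g - f)) e = (1 - t) * f e + t * g e := fun e => by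
    simp only [Pi.add_apply, Pi.smul_apply, Pi.sub_apply, smul_eq_mul]
    ring
  refine ⟨hf.add_smul (hf.tangent_sub hg) fun e => ?_, fun e he => ?_⟩
  · rw [hval]
    exact add_nonneg (mul_nonneg (sub_nonneg.2 ht₁) (hf.nonneg e)) (mul_nonneg ht₀.le (hg.nonneg e))
  · rw [hval]
    have h1 := mul_nonneg (sub_nonneg.2 ht₁) (hf.nonneg e)
    have h2 := mul_le_mul_of_nonneg_left (hf.le_one e) (sub_nonneg.2 ht₁)
    have h3 := mul_pos ht₀ (hgi e he).1
    have h4 := mul_lt_mul_of_pos_left (hgi e he).2 ht₀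
    exact ⟨by linarith, by linarith⟩

/-- Every pair lies in one row and one column, so half of each inequality covers the fractional
terms once. This costs `γ / 2` of the miss and false alarm terms; with the `(1 - γ) / 2` to be kept,
that is 1/2, within reach of `α` and `β`. -/
theorem le_hess {α β γ : ℝ} (hα : 1 / 2 < α) (hβ : 1 / 2 < β) (hγ₀ : 0 ≤ γ) (hγ₁ : γ ≤ 1)
    {w : Arr n m} (hw : ∀ e, 0 ≤ w.val e) {f d : Entry n m → ℝ} (hf : FeasibleFn w f) (hfi : IsInner w f)
    (hd : Tangent w d) :
    (1 - γ) / 2 * ∑ e, d e ^ 2 / f e ≤ hess α β γ f d := by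
  have hlt := hfi.lt_one hw hf
  have hz : ∀ e, f e = 0 → d e = 0 := fun e he => by
    rcases (hw e).eq_or_lt with h0 | h0
    · exact hd.zero e h0.symm
    · exact absurd he (hfi e h0).1.ne'
  have hs : ∀ e, 0 ≤ d e ^ 2 / (1 - f e) := fun e =>
    div_nonneg (sq_nonneg _) (sub_nonneg.2 (hlt e).le)
  have hr : ∀ e, 0 ≤ d e ^ 2 / f e := fun e => div_nonneg (sq_nonneg _) (hf.nonneg e)
  have hrow : ∀ i, ∑ j, d (Sum.inl (i, j)) ^ 2 / (1 - f (Sum.inl (i, j))) ≤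
      d (Sum.inr (Sum.inl i)) ^ 2 / f (Sum.inr (Sum.inl i)) +
        ∑ j, d (Sum.inl (i, j)) ^ 2 / f (Sum.inl (i, j)) := by
    intro i
    have := sum_sq_div_one_sub_le (fun o => hf.nonneg (Entry.row i o)) (hf.row i)
      (fun o => hlt _) (hd.row i) (fun o => hz _)
    simp only [Fintype.sum_option, Entry.row_none, Entry.row_some] at this
    linarith [hs (Sum.inr (Sum.inl i))]
  have hcol : ∀ j, ∑ i, d (Sum.inl (i, j)) ^ 2 / (1 - f (Sum.inl (i, j))) ≤
      d (Sum.inr (Sum.inr j)) ^ 2 / f (Sum.inr (Sum.inr j)) +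
        ∑ i, d (Sum.inl (i, j)) ^ 2 / f (Sum.inl (i, j)) := by
    intro j
    have := sum_sq_div_one_sub_le (fun o => hf.nonneg (Entry.col j o)) (hf.col j)
      (fun o => hlt _) (hd.col j) (fun o => hz _)
    simp only [Fintype.sum_option, Entry.col_none, Entry.col_some] at this
    linarith [hs (Sum.inr (Sum.inr j))]
  have hrows := Finset.sum_le_sum fun i (_ : i ∈ Finset.univ) => hrow i
  have hcols := Finset.sum_le_sum fun j (_ : j ∈ Finset.univ) => hcol j
  rw [Finset.sum_add_distrib] at hrows hcols
  rw [Finset.sum_comm, Finset.sum_comm (f := fun j i => d (Sum.inl (i, j)) ^ 2 / f (Sum.inl (i, j)))]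
    at hcols
  have hM : 0 ≤ ∑ i, d (Sum.inr (Sum.inl i)) ^ 2 / f (Sum.inr (Sum.inl i)) :=
    Finset.sum_nonneg fun i _ => hr _
  have hF : 0 ≤ ∑ j, d (Sum.inr (Sum.inr j)) ^ 2 / f (Sum.inr (Sum.inr j)) :=
    Finset.sum_nonneg fun j _ => hr _
  have hR : 0 ≤ ∑ i, ∑ j, d (Sum.inl (i, j)) ^ 2 / f (Sum.inl (i, j)) :=
    Finset.sum_nonneg fun i _ => Finset.sum_nonneg fun j _ => hr _
  have hexp : hess α β γ f d = (∑ i, ∑ j, d (Sum.inl (i, j)) ^ 2 / f (Sum.inl (i, j)))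
      - γ * (∑ i, ∑ j, d (Sum.inl (i, j)) ^ 2 / (1 - f (Sum.inl (i, j))))
      + α * (∑ i, d (Sum.inr (Sum.inl i)) ^ 2 / f (Sum.inr (Sum.inl i)))
      + β * (∑ j, d (Sum.inr (Sum.inr j)) ^ 2 / f (Sum.inr (Sum.inr j))) := by
    simp only [hess, Fintype.sum_sum_type, Fintype.sum_prod_type, entropyCoeff, fracCoeff,
      Sum.elim_inl, Sum.elim_inr, Finset.mul_sum, ← Finset.sum_sub_distrib, add_assoc]
    congr 1
    · exact Finset.sum_congr rfl fun i _ => Finset.sum_congr rfl fun j _ => by ring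
    · congr 1
      · exact Finset.sum_congr rfl fun i _ => by ring
      · exact Finset.sum_congr rfl fun j _ => by ring
  rw [hexp, Fintype.sum_sum_type, Fintype.sum_sum_type, Fintype.sum_prod_type]
  set R := ∑ i, ∑ j, d (Sum.inl (i, j)) ^ 2 / f (Sum.inl (i, j))
  set S := ∑ i, ∑ j, d (Sum.inl (i, j)) ^ 2 / (1 - f (Sum.inl (i, j)))
  set M := ∑ i, d (Sum.inr (Sum.inl i)) ^ 2 / f (Sum.inr (Sum.inl i))
  set F := ∑ j, d (Sum.inr (Sum.inr j)) ^ 2 / f (Sum.inr (Sum.inr j))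
  have h1 := mul_le_mul_of_nonneg_left hrows hγ₀
  have h2 := mul_le_mul_of_nonneg_left hcols hγ₀
  have h3 := mul_le_mul_of_nonneg_right hα.le hM
  have h4 := mul_le_mul_of_nonneg_right hβ.le hF
  have h5 := mul_nonneg (sub_nonneg.2 hγ₁) hR
  linarith

/-! ### Minimisers -/

theorem continuous_energy (α β γ : ℝ) (w : Arr n m) : Continuous (energy α β γ w) := by
  have h : ∀ g : (Entry n m → ℝ) → ℝ, Continuous g → Continuous fun f => g f * Real.log (g f) :=
    fun g hg => Real.continuous_mul_log.comp hg
  refine continuous_finsetSum _ fun e _ => ?_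
  exact (continuous_const.mul ((h _ (continuous_apply e)).sub
    ((continuous_apply e).mul continuous_const))).sub
    (continuous_const.mul (h _ (continuous_const.sub (continuous_apply e))))

theorem isCompact_feasibleFn (w : Arr n m) : IsCompact {f | FeasibleFn w f} := by
  refine IsCompact.of_isClosed_subset
    (isCompact_univ_pi fun _ : Entry n m => isCompact_Icc (a := (0 : ℝ)) (b := 1)) ?_
    fun f hf e _ => ⟨hf.nonneg e, hf.le_one e⟩
  have : {f | FeasibleFn w f} = {f : Entry n m → ℝ | (∀ e, 0 ≤ f e) ∧
      (∀ i, ∑ o, f (Entry.row i o) = 1) ∧ (∀ j, ∑ o, f (Entry.col j o) = 1) ∧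
      ∀ e, w.val e = 0 → f e = 0} :=
    Set.ext fun f => ⟨fun h => ⟨h.1, h.2, h.3, h.4⟩, fun h => ⟨h.1, h.2.1, h.2.2.1, h.2.2.2⟩⟩
  rw [this]
  simp only [Set.ofPred_and, Set.ofPred_forall]
  refine (isClosed_iInter fun e => isClosed_le continuous_const (continuous_apply e)).inter
    ((isClosed_iInter fun i => isClosed_eq (by fun_prop) continuous_const).inter
    ((isClosed_iInter fun j => isClosed_eq (by fun_prop) continuous_const).inter
    (isClosed_iInter fun e => isClosed_iInter fun _ =>
      isClosed_eq (continuous_apply e) continuous_const)))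

/-- `f` minimises the energy over the feasible set. -/
def IsMinFn (α β γ : ℝ) (w : Arr n m) (f : Entry n m → ℝ) : Prop :=
  FeasibleFn w f ∧ ∀ g, FeasibleFn w g → energy α β γ w f ≤ energy α β γ w g

theorem isMinimiser_iff {α β γ : ℝ} {w q : Arr n m} :
    IsMinimiser α β γ w q ↔ IsMinFn α β γ w q.val := by
  constructor
  · rintro ⟨hq, h⟩
    have hq' := feasible_iff.1 hq
    refine ⟨hq', fun g hg => ?_⟩
    have := h (Arr.of g) (feasible_iff.2 (by rwa [Arr.val_of]))
    rwa [freeEnergy_eq_energy _ _ _ hq'.zero,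
      freeEnergy_eq_energy _ _ _ (by rw [Arr.val_of]; exact hg.zero), Arr.val_of] at this
  · rintro ⟨hq, h⟩
    refine ⟨feasible_iff.2 hq, fun g hg => ?_⟩
    have hg' := feasible_iff.1 hg
    rw [freeEnergy_eq_energy _ _ _ hq.zero, freeEnergy_eq_energy _ _ _ hg'.zero]
    exact h _ hg'

theorem exists_isMinFn (α β γ : ℝ) {w : Arr n m} (h : ∃ f, FeasibleFn w f) :
    ∃ f, IsMinFn α β γ w f :=
  let ⟨f, hf, hmin⟩ := (isCompact_feasibleFn w).exists_isMinOn h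
    (continuous_energy α β γ w).continuousOn
  ⟨f, hf, fun _ hg => hmin hg⟩

theorem hasDerivAt_energy (α β γ : ℝ) {w : Arr n m} (hw : ∀ e, 0 ≤ w.val e) {f d : Entry n m → ℝ}
    (hd : Tangent w d) {t : ℝ} (hi : IsInner w (f + t • d)) :
    HasDerivAt (fun t : ℝ => energy α β γ w (f + t • d))
      (∑ e, d e * grad α β γ w (f + t • d) e) t := by
  refine HasDerivAt.fun_sum fun e _ => ?_
  rcases (hw e).eq_or_lt with h0 | h0
  -- At zero weight the direction vanishes, so the term is constant and the singularity of the
  -- logarithm at 0 is avoided.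
  · simpa [hd.zero e h0.symm] using hasDerivAt_const t _
  have hx : HasDerivAt (fun t : ℝ => (f + t • d) e) (d e) t := by
    simpa using ((hasDerivAt_id t).mul_const (d e)).const_add (f e)
  have hl := (Real.hasDerivAt_mul_log (hi e h0).1.ne').comp t hx
  have hr := (Real.hasDerivAt_mul_log (sub_pos.2 (hi e h0).2).ne').comp t (hx.const_sub 1)
  refine (((hl.sub (hx.mul_const (Real.log (w.val e)))).const_mul (entropyCoeff α β e)).sub
    (hr.const_mul (fracCoeff γ e))).congr_deriv ?_
  rw [grad]
  ring

theorem hasDerivAt_sum_grad (α β γ : ℝ) {w : Arr n m} (hw : ∀ e, 0 ≤ w.val e)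
    {f d : Entry n m → ℝ} (hd : Tangent w d) {t : ℝ} (hi : IsInner w (f + t • d)) :
    HasDerivAt (fun t : ℝ => ∑ e, d e * grad α β γ w (f + t • d) e)
      (hess α β γ (f + t • d) d) t := by
  refine HasDerivAt.fun_sum fun e _ => ?_
  rcases (hw e).eq_or_lt with h0 | h0
  · simpa [hd.zero e h0.symm] using hasDerivAt_const t _
  have hx : HasDerivAt (fun t : ℝ => (f + t • d) e) (d e) t := by
    simpa using ((hasDerivAt_id t).mul_const (d e)).const_add (f e)
  have hl := hx.log (hi e h0).1.ne'
  have hr := (hx.const_sub 1).log (sub_pos.2 (hi e h0).2).ne'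
  refine (((((hl.add_const 1).sub_const (Real.log (w.val e))).const_mul
    (entropyCoeff α β e)).add ((hr.add_const 1).const_mul (fracCoeff γ e))).const_mul
    (d e)).congr_deriv ?_
  ring

/-- If a feasible point is not inner, some entry of positive weight vanishes. -/
theorem exists_eq_zero_of_not_isInner {w : Arr n m} (hw : Nondegenerate w) {f : Entry n m → ℝ}
    (hf : FeasibleFn w f) (h : ¬ IsInner w f) : ∃ e, 0 < w.val e ∧ f e = 0 := by
  classical
  by_contra! hne
  have hpos : ∀ e, 0 < w.val e → 0 < f e := fun e he => (hf.nonneg e).lt_of_ne (hne e he).symm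
  have key : ∀ {k : ℕ} (g : Option (Fin k) → Entry n m), (∑ o, f (g o) = 1) →
      (∀ o, ∃ o' ≠ o, 0 < w.val (g o')) → ∀ o, f (g o) < 1 := by
    intro k g hg hex o
    obtain ⟨o', ho', hwo⟩ := hex o
    rw [← hg]
    exact Finset.single_lt_sum ho' (Finset.mem_univ o) (Finset.mem_univ o') (hpos _ hwo)
      fun _ _ _ => hf.nonneg _
  refine h fun e he => ⟨hpos e he, ?_⟩
  rcases e with ⟨i, j⟩ | i | j
  · exact key (Entry.row i) (hf.row i) (hw.row i) (some j)
  · exact key (Entry.row i) (hf.row i) (hw.row i) none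
  · exact key (Entry.col j) (hf.col j) (hw.col j) none

/-- The slope towards an inner point tends to -∞ at a point with a vanishing entry. An entry equal
to 1 could contribute +∞ through the fractional term, so the slope is controlled through the Hessian
bound, which treats both singularities together. -/
theorem IsMinFn.isInner {α β γ : ℝ} (hα : 1 / 2 < α) (hβ : 1 / 2 < β) (hγ₀ : 0 ≤ γ) (hγ₁ : γ < 1)
    {w : Arr n m} (hw : ∀ e, 0 ≤ w.val e) {f g : Entry n m → ℝ} (hf : IsMinFn α β γ w f)
    (hg : FeasibleFn w g) (hgi : IsInner w g) : IsInner w f := by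
  by_contra hni
  obtain ⟨a, hwa, hfa⟩ := exists_eq_zero_of_not_isInner (hgi.nondegenerate hw hg) hf.1 hni
  set d := g - f with hd
  have hdt : Tangent w d := hf.1.tangent_sub hg
  have hda : 0 < d a := by simpa [hd, hfa] using (hgi a hwa).1
  have hseg : ∀ t : ℝ, 0 < t → t ≤ 1 → FeasibleFn w (f + t • d) ∧ IsInner w (f + t • d) :=
    fun t h0 h1 => hf.1.segment hg hgi h0 h1
  set ψ : ℝ → ℝ := fun t => ∑ e, d e * grad α β γ w (f + t • d) e with hψ
  set K := (1 - γ) / 2 * d a with hK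
  have hKpos : 0 < K := mul_pos (by linarith) hda
  have hhess : ∀ t : ℝ, 0 < t → t ≤ 1 → K / t ≤ hess α β γ (f + t • d) d := by
    intro t h0 h1
    obtain ⟨hft, hit⟩ := hseg t h0 h1
    refine le_trans ?_ (le_hess hα hβ hγ₀ hγ₁.le hw hft hit hdt)
    have h2 := Finset.single_le_sum (f := fun e => d e ^ 2 / (f + t • d) e)
      (fun e _ => div_nonneg (sq_nonneg _) (hft.nonneg e)) (Finset.mem_univ a)
    have h3 : d a ^ 2 / (f + t • d) a = d a / t := by
      simp only [Pi.add_apply, hfa, Pi.smul_apply, smul_eq_mul, zero_add]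
      field_simp
    rw [h3] at h2
    rw [hK, mul_div_assoc]
    exact mul_le_mul_of_nonneg_left h2 (by linarith)
  -- `K / t` is the derivative of `K * log t`; hence `ψ t ≤ ψ (1/2) + K * (log t - log (1/2))`.
  have hmono : MonotoneOn (fun t => ψ t - K * Real.log t) (Set.Ioo 0 1) := by
    have hder : ∀ t ∈ Set.Ioo (0 : ℝ) 1, HasDerivAt (fun t => ψ t - K * Real.log t)
        (hess α β γ (f + t • d) d - K * t⁻¹) t := fun t ht =>
      (hasDerivAt_sum_grad α β γ hw hdt (hseg t ht.1 ht.2.le).2).sub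
        ((Real.hasDerivAt_log ht.1.ne').const_mul K)
    refine monotoneOn_of_deriv_nonneg (convex_Ioo 0 1)
      (fun t ht => (hder t ht).continuousAt.continuousWithinAt)
      (fun t ht => (hder t (interior_subset ht)).differentiableAt.differentiableWithinAt)
      fun t ht => ?_
    have ht' := interior_subset ht
    rw [(hder t ht').deriv, ← div_eq_mul_inv, sub_nonneg]
    exact hhess t ht'.1 ht'.2.le
  obtain ⟨t₀, ht₀, ht₀', hlog⟩ : ∃ t₀ : ℝ, 0 < t₀ ∧ t₀ < 1 / 2 ∧
      K * Real.log t₀ < K * Real.log (1 / 2) - ψ (1 / 2) := by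
    have h1 := Real.tendsto_log_nhdsGT_zero.const_mul_atBot hKpos
    have h2 := h1.eventually_lt_atBot (K * Real.log (1 / 2) - ψ (1 / 2))
    have h3 : ∀ᶠ t : ℝ in 𝓝[>] 0, t ∈ Set.Ioo (0 : ℝ) (1 / 2) := Ioo_mem_nhdsGT (by norm_num)
    obtain ⟨t, h4, h5⟩ := (h2.and h3).exists
    exact ⟨t, h5.1, h5.2, h4⟩
  have hneg : ∀ t, 0 < t → t < t₀ → ψ t < 0 := by
    intro t h0 h1
    have h2 := hmono (a := t) ⟨h0, by linarith⟩ (b := 1 / 2) ⟨by norm_num, by norm_num⟩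
      (by linarith)
    have h3 := mul_le_mul_of_nonneg_left (Real.log_le_log h0 h1.le) hKpos.le
    simp only at h2
    linarith
  have hanti : StrictAntiOn (fun t : ℝ => energy α β γ w (f + t • d)) (Set.Icc 0 t₀) := by
    refine strictAntiOn_of_deriv_neg (convex_Icc 0 t₀)
      ((continuous_energy α β γ w).comp (by fun_prop)).continuousOn fun t ht => ?_
    rw [interior_Icc] at ht
    rw [(hasDerivAt_energy α β γ hw hdt (hseg t ht.1 (by linarith [ht.2])).2).deriv]
    exact hneg t ht.1 ht.2
  have h1 := hanti ⟨le_rfl, ht₀.le⟩ ⟨ht₀.le, le_rfl⟩ ht₀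
  have h2 := hf.2 _ (hseg t₀ ht₀ (by linarith)).1
  simp only [zero_smul, add_zero] at h1
  exact absurd h1 h2.not_gt

/-- The derivatives of the energy vanish in all directions within the feasible set. -/
def Stationary (α β γ : ℝ) (w : Arr n m) (f : Entry n m → ℝ) : Prop :=
  ∀ d, Tangent w d → ∑ e, d e * grad α β γ w f e = 0

theorem IsMinFn.stationary {α β γ : ℝ} {w : Arr n m} (hw : ∀ e, 0 ≤ w.val e) {f : Entry n m → ℝ}
    (hf : IsMinFn α β γ w f) (hi : IsInner w f) : Stationary α β γ w f := by
  intro d hd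
  have hder := hasDerivAt_energy α β γ hw hd (f := f) (t := 0) (by simpa using hi)
  rw [zero_smul, add_zero] at hder
  refine IsLocalMin.hasDerivAt_eq_zero ?_ hder
  have hev : ∀ᶠ t : ℝ in 𝓝 0, ∀ e, 0 ≤ (f + t • d) e := by
    refine eventually_all.2 fun e => ?_
    rcases (hw e).eq_or_lt with h0 | h0
    · simp [hd.zero e h0.symm, hf.1.zero e h0.symm]
    · have hc : ContinuousAt (fun t : ℝ => (f + t • d) e) 0 := by
        simp only [Pi.add_apply, Pi.smul_apply, smul_eq_mul]
        fun_prop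
      filter_upwards [hc.eventually_const_lt (by simpa using (hi e h0).1)] with t ht using ht.le
  filter_upwards [hev] with t ht
  simpa using hf.2 _ (hf.1.add_smul hd ht)

/-- The energy has at most one stationary inner feasible point. -/
theorem Stationary.eq {α β γ : ℝ} (hα : 1 / 2 < α) (hβ : 1 / 2 < β) (hγ₀ : 0 ≤ γ) (hγ₁ : γ < 1)
    {w : Arr n m} (hw : ∀ e, 0 ≤ w.val e) {f g : Entry n m → ℝ} (hf : FeasibleFn w f)
    (hfi : IsInner w f) (hfs : Stationary α β γ w f) (hg : FeasibleFn w g) (hgi : IsInner w g)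
    (hgs : Stationary α β γ w g) : f = g := by
  have hd := hf.tangent_sub hg
  have hseg : ∀ t : ℝ, 0 ≤ t → t ≤ 1 →
      FeasibleFn w (f + t • (g - f)) ∧ IsInner w (f + t • (g - f)) := by
    intro t h0 h1
    rcases h0.eq_or_lt with rfl | h0
    · simpa using ⟨hf, hfi⟩
    · exact hf.segment hg hgi h0 h1
  have hder : ∀ t : ℝ, 0 ≤ t → t ≤ 1 → _ := fun t h0 h1 =>
    hasDerivAt_sum_grad α β γ hw hd (hseg t h0 h1).2
  -- Rolle's theorem for the slope, which is zero at both ends, makes the Hessian vanish at some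
  -- point of the segment.
  obtain ⟨t, ht, h0⟩ := exists_hasDerivAt_eq_zero one_pos
    (fun t ht => (hder t ht.1 ht.2).continuousAt.continuousWithinAt)
    (by simp only [zero_smul, add_zero, one_smul, add_sub_cancel, hfs _ hd, hgs _ hd]) fun t ht => hder t ht.1.le ht.2.le
  obtain ⟨hft, hit⟩ := hseg t ht.1.le ht.2.le
  have h1 := le_hess hα hβ hγ₀ hγ₁.le hw hft hit hd
  rw [h0] at h1
  have hterm : ∀ e, 0 ≤ (g - f) e ^ 2 / (f + t • (g - f)) e := fun e =>
    div_nonneg (sq_nonneg _) (hft.nonneg e)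
  have hsum : ∑ e, (g - f) e ^ 2 / (f + t • (g - f)) e = 0 :=
    le_antisymm (nonpos_of_mul_nonpos_right h1 (by linarith)) (Finset.sum_nonneg fun e _ => hterm e)
  rw [Finset.sum_eq_zero_iff_of_nonneg fun e _ => hterm e] at hsum
  ext e
  rcases (hw e).eq_or_lt with hwe | hwe
  · rw [hf.zero e hwe.symm, hg.zero e hwe.symm]
  · have := hsum e (Finset.mem_univ e)
    rw [div_eq_zero_iff, or_iff_left (hit e hwe).1.ne', sq_eq_zero_iff, Pi.sub_apply,
      sub_eq_zero] at this
    exact this.symm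

/-! ### Lagrange multipliers -/

/-- `lam` and `mu` are Lagrange multipliers of the row and column constraints at `f`. -/
structure Multipliers (α β γ : ℝ) (w : Arr n m) (f : Entry n m → ℝ) (lam : Fin n → ℝ)
    (mu : Fin m → ℝ) : Prop where
  pair : ∀ i j, 0 < w.pair i j → grad α β γ w f (Sum.inl (i, j)) = lam i + mu j
  miss : ∀ i, 0 < w.miss i → grad α β γ w f (Sum.inr (Sum.inl i)) = lam i
  fa : ∀ j, 0 < w.fa j → grad α β γ w f (Sum.inr (Sum.inr j)) = mu j

/-- A functional vanishing on the common kernel of the constraint functionals is a combination of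
them. The multipliers of the constraints `d e = 0` are invisible at entries of positive weight. -/
theorem Stationary.exists_multipliers {α β γ : ℝ} {w : Arr n m} {f : Entry n m → ℝ}
    (h : Stationary α β γ w f) : ∃ lam mu, Multipliers α β γ w f lam mu := by
  classical
  let P : Entry n m → (Entry n m → ℝ) →ₗ[ℝ] ℝ := fun e => LinearMap.proj e
  let L : Fin n ⊕ Fin m ⊕ {e : Entry n m // w.val e = 0} → (Entry n m → ℝ) →ₗ[ℝ] ℝ :=
    Sum.elim (fun i => ∑ o, P (Entry.row i o))
      (Sum.elim (fun j => ∑ o, P (Entry.col j o)) fun e => P e)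
  let G : (Entry n m → ℝ) →ₗ[ℝ] ℝ := ∑ e, grad α β γ w f e • P e
  have hG : ∀ d, G d = ∑ e, d e * grad α β γ w f e := fun d => by
    simp [G, P, mul_comm]
  have hmem : G ∈ Submodule.span ℝ (Set.range L) := by
    refine mem_span_of_iInf_ker_le_ker fun d hd => ?_
    rw [Submodule.mem_iInf] at hd
    rw [LinearMap.mem_ker, hG]
    refine h d ⟨fun i => ?_, fun j => ?_, fun e he => ?_⟩
    · simpa [L, P] using hd (Sum.inl i)
    · simpa [L, P] using hd (Sum.inr (Sum.inl j))
    · simpa [L, P] using hd (Sum.inr (Sum.inr ⟨e, he⟩))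
  obtain ⟨c, hc⟩ := (Submodule.mem_span_range_iff_exists_fun ℝ).1 hmem
  have hc' : ∀ d : Entry n m → ℝ, ∑ e, d e * grad α β γ w f e =
      ∑ i, c (Sum.inl i) * (d (Sum.inr (Sum.inl i)) + ∑ j, d (Sum.inl (i, j))) +
      (∑ j, c (Sum.inr (Sum.inl j)) * (d (Sum.inr (Sum.inr j)) + ∑ i, d (Sum.inl (i, j))) +
      ∑ x : {e : Entry n m // w.val e = 0}, c (Sum.inr (Sum.inr x)) * d x) := by
    intro d
    rw [← hG, ← hc]
    simp only [LinearMap.sum_apply, LinearMap.add_apply, LinearMap.smul_apply,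
      Fintype.sum_sum_type, L, P, Sum.elim_inl, Sum.elim_inr, LinearMap.proj_apply, smul_eq_mul,
      Fintype.sum_option, Entry.row_none, Entry.row_some, Entry.col_none, Entry.col_some]
  have hval : ∀ e, 0 < w.val e → grad α β γ w f e =
      ∑ i, c (Sum.inl i) * ((if Sum.inr (Sum.inl i) = e then 1 else 0) +
        ∑ j, if Sum.inl (i, j) = e then 1 else 0) +
      ∑ j, c (Sum.inr (Sum.inl j)) * ((if Sum.inr (Sum.inr j) = e then 1 else 0) +
        ∑ i, if Sum.inl (i, j) = e then 1 else 0) := by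
    intro e he
    -- Coefficients are read off on indicator vectors.
    have h1 := hc' fun x => if x = e then 1 else 0
    have h2 : ∀ x : {e : Entry n m // w.val e = 0}, ¬ (x : Entry n m) = e := by
      rintro ⟨x, hx⟩ rfl
      exact he.ne' hx
    simpa only [ite_mul, one_mul, zero_mul, Finset.sum_ite_eq', Finset.mem_univ,
      if_true, h2, if_false, mul_zero, Finset.sum_const_zero, add_zero] using h1
  refine ⟨fun i => c (Sum.inl i), fun j => c (Sum.inr (Sum.inl j)), fun i j hij => ?_,
    fun i hi => ?_, fun j hj => ?_⟩
  · rw [hval (Sum.inl (i, j)) hij]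
    simp [ite_and, -Finset.sum_boole]
  · rw [hval (Sum.inr (Sum.inl i)) hi]
    simp
  · rw [hval (Sum.inr (Sum.inr j)) hj]
    simp

theorem Multipliers.stationary {α β γ : ℝ} {w : Arr n m} (hw : ∀ e, 0 ≤ w.val e)
    {f : Entry n m → ℝ} {lam : Fin n → ℝ} {mu : Fin m → ℝ} (h : Multipliers α β γ w f lam mu) :
    Stationary α β γ w f := by
  intro d hd
  have h1 : ∀ i j, d (Sum.inl (i, j)) * grad α β γ w f (Sum.inl (i, j)) =
      lam i * d (Sum.inl (i, j)) + mu j * d (Sum.inl (i, j)) := by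
    intro i j
    rcases (hw (Sum.inl (i, j))).eq_or_lt with h0 | h0
    · simp [hd.zero _ h0.symm]
    · rw [h.pair i j h0]
      ring
  have h2 : ∀ i, d (Sum.inr (Sum.inl i)) * grad α β γ w f (Sum.inr (Sum.inl i)) =
      lam i * d (Sum.inr (Sum.inl i)) := by
    intro i
    rcases (hw (Sum.inr (Sum.inl i))).eq_or_lt with h0 | h0
    · simp [hd.zero _ h0.symm]
    · rw [h.miss i h0, mul_comm]
  have h3 : ∀ j, d (Sum.inr (Sum.inr j)) * grad α β γ w f (Sum.inr (Sum.inr j)) =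
      mu j * d (Sum.inr (Sum.inr j)) := by
    intro j
    rcases (hw (Sum.inr (Sum.inr j))).eq_or_lt with h0 | h0
    · simp [hd.zero _ h0.symm]
    · rw [h.fa j h0, mul_comm]
  have hr : ∑ i, lam i * ∑ o, d (Entry.row i o) = 0 := by simp [hd.row]
  have hc : ∑ j, mu j * ∑ o, d (Entry.col j o) = 0 := by simp [hd.col]
  simp only [Fintype.sum_option, Entry.row_none, Entry.row_some, Entry.col_none, Entry.col_some,
    mul_add, Finset.mul_sum, Finset.sum_add_distrib] at hr hc
  rw [Finset.sum_comm] at hc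
  simp only [Fintype.sum_sum_type, Fintype.sum_prod_type, h1, h2, h3, Finset.sum_add_distrib]
  linarith

/-! ### From multipliers to a fixed point of belief propagation -/

/-- The optimality conditions in multiplicative form. -/
structure Balanced (α β γ : ℝ) (w q : Arr n m) (a : Fin n → ℝ) (b : Fin m → ℝ) : Prop where
  row_pos : ∀ i, 0 < a i
  col_pos : ∀ j, 0 < b j
  pair : ∀ i j, q.pair i j * (1 - q.pair i j) ^ γ =
    w.pair i j * a i * b j * Real.exp (α + β - 1 - γ)
  miss : ∀ i, q.miss i = w.miss i * a i ^ (1 / α)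
  fa : ∀ j, q.fa j = w.fa j * b j ^ (1 / β)

theorem Balanced.transpose {α β γ : ℝ} {w q : Arr n m} {a : Fin n → ℝ} {b : Fin m → ℝ}
    (h : Balanced α β γ w q a b) : Balanced β α γ w.transpose q.transpose b a where
  row_pos := h.col_pos
  col_pos := h.row_pos
  pair j i := by
    have := h.pair i j
    simp only [Arr.transpose]
    rw [this, add_comm β α]
    ring
  miss := h.fa
  fa := h.miss

theorem FeasibleFn.transpose {w q : Arr n m} (h : FeasibleFn w q.val) :
    FeasibleFn w.transpose q.transpose.val where
  nonneg e := by simpa using h.nonneg e.swap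
  row i := by simpa using h.col i
  col j := by simpa using h.row j
  zero e he := by simpa using h.zero e.swap (by simpa using he)

/-- An equation `s * log (p / v) + s = l` of the optimality conditions, solved for `p`. -/
theorem eq_mul_rpow_of_log {s l p v : ℝ} (hs : 0 < s) (hp : 0 < p) (hv : 0 < v)
    (h : s * (Real.log p + 1 - Real.log v) = l) : p = v * Real.exp (l - s) ^ (1 / s) := by
  rw [← Real.exp_mul]
  nth_rw 1 [← Real.exp_log hp, ← Real.exp_log hv]
  rw [← Real.exp_add]
  congr 1
  rw [← h]
  field_simp
  ring

theorem Multipliers.balanced {α β γ : ℝ} (hα : 0 < α) (hβ : 0 < β) {w q : Arr n m}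
    (hw : ∀ e, 0 ≤ w.val e) (hq : FeasibleFn w q.val) (hqi : IsInner w q.val) {lam : Fin n → ℝ}
    {mu : Fin m → ℝ} (h : Multipliers α β γ w q.val lam mu) :
    Balanced α β γ w q (fun i => Real.exp (lam i - α)) (fun j => Real.exp (mu j - β)) where
  row_pos _ := Real.exp_pos _
  col_pos _ := Real.exp_pos _
  pair i j := by
    rcases (hw (Sum.inl (i, j))).eq_or_lt with h0 | h0
    · have h1 : q.pair i j = 0 := hq.zero _ h0.symm
      rw [Arr.val_pair] at h0
      simp [h1, ← h0]
    · have hi := hqi _ h0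
      have hg := h.pair i j h0
      simp only [Arr.val_pair, grad, entropyCoeff, fracCoeff, Sum.elim_inl] at h0 hi hg
      rw [Real.rpow_def_of_pos (sub_pos.2 hi.2)]
      nth_rw 1 [← Real.exp_log hi.1]
      nth_rw 1 [← Real.exp_log h0]
      simp only [← Real.exp_add]
      congr 1
      linarith
  miss i := by
    rcases (hw (Sum.inr (Sum.inl i))).eq_or_lt with h0 | h0
    · have h1 : q.miss i = 0 := hq.zero _ h0.symm
      rw [Arr.val_miss] at h0
      simp [h1, ← h0]
    · have hg := h.miss i h0
      simp only [grad, entropyCoeff, fracCoeff, Sum.elim_inl, Sum.elim_inr, zero_mul,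
        add_zero] at hg
      exact eq_mul_rpow_of_log hα (hqi _ h0).1 h0 hg
  fa j := by
    rcases (hw (Sum.inr (Sum.inr j))).eq_or_lt with h0 | h0
    · have h1 : q.fa j = 0 := hq.zero _ h0.symm
      rw [Arr.val_fa] at h0
      simp [h1, ← h0]
    · have hg := h.fa j h0
      simp only [grad, entropyCoeff, fracCoeff, Sum.elim_inr, zero_mul, add_zero] at hg
      exact eq_mul_rpow_of_log hβ (hqi _ h0).1 h0 hg

/-- The messages `x` of the fixed point with beliefs `q` and potentials `a`, `b`. -/
noncomputable def fixedX (α β γ : ℝ) (q : Arr n m) (a : Fin n → ℝ) (b : Fin m → ℝ) : Arr n m where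
  pair i j := b j * (1 - q.pair i j) ^ (-γ) * Real.exp (α + β - 1 - γ)
  miss i := a i ^ (1 / α - 1)
  fa := b

/-- The messages `y` of the fixed point with beliefs `q` and potentials `a`, `b`. -/
noncomputable def fixedY (α β γ : ℝ) (q : Arr n m) (a : Fin n → ℝ) (b : Fin m → ℝ) : Arr n m where
  pair i j := a i * (1 - q.pair i j) ^ (-γ) * Real.exp (α + β - 1 - γ)
  miss := a
  fa j := b j ^ (1 / β - 1)

/-- Normalising a column: with total `b⁻¹` and remaining mass `(1 - p) / b`, the two powers in the
update combine to `b * (1 - p) ^ (-γ)`. -/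
theorem inv_rpow_mul_div_rpow {b p : ℝ} (γ : ℝ) (hb : 0 < b) (hp : p < 1) :
    b⁻¹ ^ (-(1 - γ)) * ((1 - p) / b) ^ (-γ) = b * (1 - p) ^ (-γ) := by
  rw [Real.div_rpow (sub_pos.2 hp).le hb.le, Real.inv_rpow hb.le, ← Real.rpow_neg hb.le, neg_neg,
    ← mul_div_assoc, mul_comm, mul_div_assoc, ← Real.rpow_sub hb]
  norm_num
  ring

/-- The weighted messages in column `j` are the beliefs divided by `b j`: they sum to `1 / b j`, and
to `(1 - q i j) / b j` with entry `i` removed. -/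
theorem Balanced.stepR_fixedY {α β γ : ℝ} {w q : Arr n m} {a : Fin n → ℝ} {b : Fin m → ℝ}
    (h : Balanced α β γ w q a b) (hq : FeasibleFn w q.val) (hlt : ∀ e, q.val e < 1) :
    stepR α β γ w (fixedY α β γ q a b) = fixedX α β γ q a b := by
  have hpair : ∀ i j, w.pair i j * (fixedY α β γ q a b).pair i j = q.pair i j / b j := by
    intro i j
    have h1 : 0 < 1 - q.pair i j := sub_pos.2 (hlt (Sum.inl (i, j)))
    have h2 : 0 < (1 - q.pair i j) ^ γ := Real.rpow_pos_of_pos h1 γ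
    simp only [fixedY]
    rw [eq_div_iff (h.col_pos j).ne', Real.rpow_neg h1.le, ← mul_right_cancel_iff_of_pos h2,
      h.pair i j]
    field_simp
  have hfa : ∀ j, w.fa j * (fixedY α β γ q a b).fa j = q.fa j / b j := by
    intro j
    simp only [fixedY]
    rw [h.fa, Real.rpow_sub_one (h.col_pos j).ne', mul_div_assoc]
  have hcol : ∀ j, q.fa j / b j + ∑ i, q.pair i j / b j = (b j)⁻¹ := by
    intro j
    have := hq.col j
    simp only [Fintype.sum_option, Entry.col_none, Entry.col_some, Arr.val_fa, Arr.val_pair] at this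
    rw [← Finset.sum_div, ← add_div, this, one_div]
  ext i j
  · simp only [stepR, hpair, hfa]
    rw [Finset.sum_erase_eq_sub (Finset.mem_univ i), ← add_sub_assoc, hcol, ← one_div, ← sub_div,
      one_div, inv_rpow_mul_div_rpow γ (h.col_pos j) (by exact hlt (Sum.inl (i, j)))]
    rfl
  · rfl
  · simp only [stepR, hpair, hfa, hcol, inv_inv]
    rfl

theorem Balanced.stepS_fixedX {α β γ : ℝ} {w q : Arr n m} {a : Fin n → ℝ} {b : Fin m → ℝ}
    (h : Balanced α β γ w q a b) (hq : FeasibleFn w q.val) (hlt : ∀ e, q.val e < 1) :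
    stepS α β γ w (fixedX α β γ q a b) = fixedY α β γ q a b := by
  have h1 : (fixedX α β γ q a b).transpose = fixedY β α γ q.transpose b a := by
    simp [fixedX, fixedY, Arr.transpose, add_comm α β]
  have h2 : (fixedX β α γ q.transpose b a).transpose = fixedY α β γ q a b := by
    simp [fixedX, fixedY, Arr.transpose, add_comm α β]
  rw [stepS_eq_transpose, h1, h.transpose.stepR_fixedY hq.transpose fun e => by
    simpa using hlt e.swap, h2]

theorem Balanced.fixedY_pos {α β γ : ℝ} {w q : Arr n m} {a : Fin n → ℝ} {b : Fin m → ℝ}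
    (h : Balanced α β γ w q a b) (hlt : ∀ e, q.val e < 1) : (fixedY α β γ q a b).Pos :=
  ⟨fun i j => mul_pos (mul_pos (h.row_pos i)
    (Real.rpow_pos_of_pos (sub_pos.2 (hlt (Sum.inl (i, j)))) _)) (Real.exp_pos _), h.row_pos,
    fun j => Real.rpow_pos_of_pos (h.col_pos j) _⟩

/-! ### From a fixed point of belief propagation to multipliers -/

section fixedPoint
variable {α β γ : ℝ} {w x y : Arr n m}

theorem col_sum_of_stepR (hR : stepR α β γ w y = x) (j : Fin m) :
    w.fa j * y.fa j + ∑ i, w.pair i j * y.pair i j = (x.fa j)⁻¹ := by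
  rw [← hR, stepR, inv_inv]

theorem belief_lt_one_of_stepR (hw : Nondegenerate w) (hx : x.Pos) (hy : y.Pos)
    (hR : stepR α β γ w y = x) (i : Fin n) (j : Fin m) :
    w.pair i j * y.pair i j * x.fa j < 1 := by
  obtain ⟨o, ho, hwo⟩ := hw.col j (some i)
  have h1 := Finset.single_lt_sum (s := Finset.univ) (i := some i) (j := o)
    (f := fun o => w.val (Entry.col j o) * y.val (Entry.col j o)) ho (Finset.mem_univ _)
    (Finset.mem_univ _) (mul_pos hwo (Arr.pos_iff.1 hy _))
    fun o _ _ => mul_nonneg (hw.nonneg _) (Arr.pos_iff.1 hy _).le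
  simp only [Fintype.sum_option, Entry.col_none, Entry.col_some, Arr.val_fa, Arr.val_pair,
    col_sum_of_stepR hR] at h1
  rwa [← one_div, lt_div_iff₀ (hx.2.2 j)] at h1

/-- Removing one entry leaves the fraction `1 - p` of the column total, where `p` is the belief of
that entry. -/
theorem pair_eq_of_stepR (hw : Nondegenerate w) (hx : x.Pos) (hy : y.Pos)
    (hR : stepR α β γ w y = x) (i : Fin n) (j : Fin m) :
    x.pair i j = x.fa j * (1 - w.pair i j * y.pair i j * x.fa j) ^ (-γ) *
      Real.exp (α + β - 1 - γ) := by
  rw [← inv_rpow_mul_div_rpow γ (hx.2.2 j) (belief_lt_one_of_stepR hw hx hy hR i j)]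
  have h1 : (1 - w.pair i j * y.pair i j * x.fa j) / x.fa j =
      (x.fa j)⁻¹ - w.pair i j * y.pair i j := by
    rw [sub_div, one_div, mul_div_cancel_right₀ _ (hx.2.2 j).ne']
  rw [h1, ← col_sum_of_stepR hR j, add_sub_assoc, ← Finset.sum_erase_eq_sub (Finset.mem_univ i)]
  nth_rw 1 [← hR]
  rfl

theorem stepR_transpose (hS : stepS α β γ w x = y) :
    stepR β α γ w.transpose x.transpose = y.transpose := by
  rw [← hS, stepS_eq_transpose]
  rfl

theorem Arr.Pos.transpose (hx : x.Pos) : x.transpose.Pos :=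
  ⟨fun j i => hx.1 i j, hx.2.2, hx.2.1⟩

/-- The two half-iterations yield the same beliefs at a fixed point. -/
theorem belief_eq_of_fixed (hγ₀ : 0 ≤ γ) (hw : Nondegenerate w) (hx : x.Pos)
    (hy : y.Pos) (hR : stepR α β γ w y = x) (hS : stepS α β γ w x = y) (i : Fin n) (j : Fin m) :
    w.pair i j * x.pair i j * y.miss i = w.pair i j * y.pair i j * x.fa j := by
  have hS' := stepR_transpose hS
  have h1 := pair_eq_of_stepR hw hx hy hR i j
  have h2 := pair_eq_of_stepR hw.transpose hy.transpose hx.transpose hS' j i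
  have l1 := belief_lt_one_of_stepR hw hx hy hR i j
  have l2 := belief_lt_one_of_stepR hw.transpose hy.transpose hx.transpose hS' j i
  simp only [Arr.transpose, add_comm β α] at h2 l2
  set p := w.pair i j * y.pair i j * x.fa j with hp
  set r := w.pair i j * x.pair i j * y.miss i with hr
  have hw0 : 0 ≤ w.pair i j := hw.nonneg (Sum.inl (i, j))
  have hp0 : 0 ≤ p := mul_nonneg (mul_nonneg hw0 (hy.1 i j).le) (hx.2.2 j).le
  have hr0 : 0 ≤ r := mul_nonneg (mul_nonneg hw0 (hx.1 i j).le) (hy.2.1 i).le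
  have q1 : 0 < (1 - p) ^ γ := Real.rpow_pos_of_pos (sub_pos.2 l1) γ
  have q2 : 0 < (1 - r) ^ γ := Real.rpow_pos_of_pos (sub_pos.2 l2) γ
  rw [Real.rpow_neg (sub_pos.2 l1).le] at h1
  rw [Real.rpow_neg (sub_pos.2 l2).le] at h2
  -- Both sides are the same product of potentials; `t / (1 - t) ^ γ` thus agrees at `r` and `p`,
  -- and it is strictly increasing.
  have h3 : r * (1 - p) ^ γ = p * (1 - r) ^ γ := by
    have e1 : r = w.pair i j * x.fa j * y.miss i * Real.exp (α + β - 1 - γ) *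
        ((1 - p) ^ γ)⁻¹ := by
      rw [hr, h1]
      ring
    have e2 : p = w.pair i j * x.fa j * y.miss i * Real.exp (α + β - 1 - γ) *
        ((1 - r) ^ γ)⁻¹ := by
      rw [hp, h2]
      ring
    exact ((eq_mul_inv_iff_mul_eq₀ q1.ne').1 e1).trans ((eq_mul_inv_iff_mul_eq₀ q2.ne').1 e2).symm
  rcases lt_trichotomy r p with h | h | h
  · have h4 := Real.rpow_le_rpow (sub_pos.2 l1).le (by linarith : 1 - p ≤ 1 - r) hγ₀
    have h5 := mul_le_mul_of_nonneg_left h4 hr0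
    have h6 := mul_lt_mul_of_pos_right h q2
    linarith
  · exact h
  · have h4 := Real.rpow_le_rpow (sub_pos.2 l2).le (by linarith : 1 - r ≤ 1 - p) hγ₀
    have h5 := mul_le_mul_of_nonneg_left h4 hp0
    have h6 := mul_lt_mul_of_pos_right h q1
    linarith

theorem beliefS_eq_beliefR (hγ₀ : 0 ≤ γ) (hw : Nondegenerate w) (hx : x.Pos)
    (hy : y.Pos) (hR : stepR α β γ w y = x) (hS : stepS α β γ w x = y) :
    beliefS α β w x y = beliefR α β w y x := by
  ext i j
  exacts [belief_eq_of_fixed hγ₀ hw hx hy hR hS i j, rfl, rfl]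

/-- The first half normalises columns and the second normalises rows; at a fixed point the two
beliefs coincide, so both constraints hold at once. -/
theorem beliefR_feasible (hγ₀ : 0 ≤ γ) (hw : Nondegenerate w) (hx : x.Pos)
    (hy : y.Pos) (hR : stepR α β γ w y = x) (hS : stepS α β γ w x = y) :
    FeasibleFn w (beliefR α β w y x).val := by
  have hcol : ∀ j, w.fa j * x.fa j ^ (1 / β) + ∑ i, w.pair i j * y.pair i j * x.fa j = 1 := by
    intro j
    have h1 : y.fa j = x.fa j ^ (1 / β - 1) := by rw [← hS]; rfl
    have h2 := col_sum_of_stepR hR j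
    rw [← Finset.sum_mul]
    rw [h1, Real.rpow_sub_one (hx.2.2 j).ne'] at h2
    have h3 := congrArg (· * x.fa j) h2
    simp only [add_mul, inv_mul_cancel₀ (hx.2.2 j).ne'] at h3
    rwa [mul_assoc, div_mul_cancel₀ _ (hx.2.2 j).ne'] at h3
  have hrow : ∀ i, w.miss i * y.miss i ^ (1 / α) + ∑ j, w.pair i j * y.pair i j * x.fa j = 1 := by
    intro i
    have h1 : x.miss i = y.miss i ^ (1 / α - 1) := by rw [← hR]; rfl
    have h2 := col_sum_of_stepR (stepR_transpose hS) i
    simp only [Arr.transpose] at h2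
    simp only [← belief_eq_of_fixed hγ₀ hw hx hy hR hS]
    rw [← Finset.sum_mul]
    rw [h1, Real.rpow_sub_one (hy.2.1 i).ne'] at h2
    have h3 := congrArg (· * y.miss i) h2
    simp only [add_mul, inv_mul_cancel₀ (hy.2.1 i).ne'] at h3
    rwa [mul_assoc, div_mul_cancel₀ _ (hy.2.1 i).ne'] at h3
  refine ⟨?_, fun i => ?_, fun j => ?_, ?_⟩
  · rintro (⟨i, j⟩ | i | j)
    · exact mul_nonneg (mul_nonneg (hw.nonneg (Sum.inl (i, j))) (hy.1 i j).le) (hx.2.2 j).le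
    · exact mul_nonneg (hw.nonneg (Sum.inr (Sum.inl i))) (Real.rpow_nonneg (hy.2.1 i).le _)
    · exact mul_nonneg (hw.nonneg (Sum.inr (Sum.inr j))) (Real.rpow_nonneg (hx.2.2 j).le _)
  · simpa [Fintype.sum_option, beliefR] using hrow i
  · simpa [Fintype.sum_option, beliefR] using hcol j
  · rintro (⟨i, j⟩ | i | j) h0
    · simp_all [beliefR]
    · simp_all [beliefR]
    · simp_all [beliefR]

theorem beliefR_isInner (hγ₀ : 0 ≤ γ) (hw : Nondegenerate w) (hx : x.Pos)
    (hy : y.Pos) (hR : stepR α β γ w y = x) (hS : stepS α β γ w x = y) :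
    IsInner w (beliefR α β w y x).val := by
  by_contra h
  obtain ⟨e, he, h0⟩ :=
    exists_eq_zero_of_not_isInner hw (beliefR_feasible hγ₀ hw hx hy hR hS) h
  refine absurd h0 (ne_of_gt ?_)
  rcases e with ⟨i, j⟩ | i | j
  · exact mul_pos (mul_pos he (hy.1 i j)) (hx.2.2 j)
  · exact mul_pos he (Real.rpow_pos_of_pos (hy.2.1 i) _)
  · exact mul_pos he (Real.rpow_pos_of_pos (hx.2.2 j) _)

theorem mul_log_mul_rpow {s t v : ℝ} (hs : s ≠ 0) (ht : 0 < t) (hv : 0 < v) :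
    s * (Real.log (v * t ^ (1 / s)) + 1 - Real.log v) = Real.log t + s := by
  rw [Real.log_mul hv.ne' (Real.rpow_pos_of_pos ht _).ne', Real.log_rpow ht]
  field_simp
  ring

/-- The normalising messages are the exponentiated multipliers, shifted by the entropy coefficients;
the shifts account for `α + β - 1 - γ`. -/
theorem beliefR_multipliers (hα : α ≠ 0) (hβ : β ≠ 0) (hγ₀ : 0 ≤ γ) (hw : Nondegenerate w)
    (hx : x.Pos) (hy : y.Pos) (hR : stepR α β γ w y = x) (hS : stepS α β γ w x = y) :
    Multipliers α β γ w (beliefR α β w y x).val (fun i => Real.log (y.miss i) + α)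
      (fun j => Real.log (x.fa j) + β) where
  pair i j hij := by
    have h1 := pair_eq_of_stepR hw.transpose hy.transpose hx.transpose (stepR_transpose hS) j i
    have l1 := belief_lt_one_of_stepR hw hx hy hR i j
    simp only [Arr.transpose, belief_eq_of_fixed hγ₀ hw hx hy hR hS, add_comm β α] at h1
    have h2 : Real.log (y.pair i j) = Real.log (y.miss i) +
        -γ * Real.log (1 - w.pair i j * y.pair i j * x.fa j) + (α + β - 1 - γ) := by
      have hpow := Real.rpow_pos_of_pos (sub_pos.2 l1) (-γ)
      nth_rw 1 [h1]
      rw [Real.log_mul (mul_pos (hy.2.1 i) hpow).ne' (Real.exp_pos _).ne', Real.log_exp,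
        Real.log_mul (hy.2.1 i).ne' hpow.ne', Real.log_rpow (sub_pos.2 l1)]
    have h3 : Real.log (w.pair i j * y.pair i j * x.fa j) =
        Real.log (w.pair i j) + Real.log (y.pair i j) + Real.log (x.fa j) := by
      rw [Real.log_mul (mul_pos hij (hy.1 i j)).ne' (hx.2.2 j).ne',
        Real.log_mul hij.ne' (hy.1 i j).ne']
    simp only [grad, entropyCoeff, fracCoeff, Sum.elim_inl, Arr.val_pair, beliefR]
    rw [h3]
    linarith
  miss i hi := by
    simp only [grad, entropyCoeff, fracCoeff, Sum.elim_inl, Sum.elim_inr, Arr.val_miss, beliefR,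
      zero_mul, add_zero]
    exact mul_log_mul_rpow hα (hy.2.1 i) hi
  fa j hj := by
    simp only [grad, entropyCoeff, fracCoeff, Sum.elim_inr, Arr.val_fa, beliefR, zero_mul,
      add_zero]
    exact mul_log_mul_rpow hβ (hx.2.2 j) hj

end fixedPoint

/-! ### Convergence -/

theorem Arr.eq_of_exp {a : Arr n m} (ha : a.Pos) :
    a = Arr.of (Real.exp ∘ fun e => Real.log (a.val e)) := by
  apply Arr.val_injective
  ext e
  simp [Real.exp_log (Arr.pos_iff.1 ha e)]

theorem Arr.of_exp_pos (u : Entry n m → ℝ) : (Arr.of (Real.exp ∘ u)).Pos :=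
  Arr.pos_iff.2 fun e => by simp [Real.exp_pos]

theorem Arr.of_exp_injective : Injective fun u : Entry n m → ℝ => Arr.of (Real.exp ∘ u) := by
  intro u v h
  have := congrArg Arr.val h
  simp only [Arr.val_of] at this
  exact Real.exp_injective.comp_left this

theorem Arr.convergesTo_of_exp {u : ℕ → Entry n m → ℝ} {z : Entry n m → ℝ}
    (h : Tendsto u atTop (𝓝 z)) :
    Arr.ConvergesTo (fun k => Arr.of (Real.exp ∘ u k)) (Arr.of (Real.exp ∘ z)) := by
  refine Arr.convergesTo_iff.2 fun e => ?_
  simp only [Arr.val_of, comp_apply]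
  exact (Real.continuous_exp.tendsto _).comp (tendsto_pi_nhds.1 h e)

theorem yMsg_exp (α β γ : ℝ) {w : Arr n m} (hw : Nondegenerate w) (u : Entry n m → ℝ) (k : ℕ) :
    yMsg α β γ w (Arr.of (Real.exp ∘ u)) k = Arr.of (Real.exp ∘ (logIter α β γ w)^[k] u) := by
  induction k with
  | zero => rfl
  | succ k ih => rw [yMsg, ih, stepR_exp _ _ _ hw, stepS_exp _ _ _ hw, iterate_succ_apply']; rfl

theorem tendsto_logStepR {α β γ : ℝ} (hα : 1 / 2 < α) (hγ₀ : 0 ≤ γ) (hγ₁ : γ < 1) {w : Arr n m}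
    (hw : Nondegenerate w) {u : ℕ → Entry n m → ℝ} {z : Entry n m → ℝ}
    (h : Tendsto u atTop (𝓝 z)) :
    Tendsto (fun k => logStepR α β γ w (u k)) atTop (𝓝 (logStepR α β γ w z)) := by
  have hlip : LipschitzWith 1 (logStepR α β γ w) := by
    refine LipschitzWith.of_dist_le_mul fun u v => ?_
    rw [NNReal.coe_one, one_mul, dist_eq_norm, dist_eq_norm,
      pi_norm_le_iff_of_nonneg (norm_nonneg _)]
    exact abs_logStepR_sub_le hα hγ₀ hγ₁ hw fun e => norm_le_pi_norm (u - v) e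
  exact (hlip.continuous.tendsto z).comp h

theorem convergesTo_beliefR {α β : ℝ} {w x y : Arr n m} {xs ys : ℕ → Arr n m} (hx : x.Pos)
    (hy : y.Pos) (hxs : Arr.ConvergesTo xs x) (hys : Arr.ConvergesTo ys y) :
    Arr.ConvergesTo (fun k => beliefR α β w (ys k) (xs k)) (beliefR α β w y x) :=
  ⟨fun i j => ((hys.1 i j).const_mul _).mul (hxs.2.2 j),
    fun i => ((hys.2.1 i).rpow_const (Or.inl (hy.2.1 i).ne')).const_mul _,
    fun j => ((hxs.2.2 j).rpow_const (Or.inl (hx.2.2 j).ne')).const_mul _⟩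

theorem convergesTo_beliefS {α β : ℝ} {w x y : Arr n m} {xs ys : ℕ → Arr n m} (hx : x.Pos)
    (hy : y.Pos) (hxs : Arr.ConvergesTo xs x) (hys : Arr.ConvergesTo ys y) :
    Arr.ConvergesTo (fun k => beliefS α β w (xs k) (ys k)) (beliefS α β w x y) :=
  ⟨fun i j => ((hxs.1 i j).const_mul _).mul (hys.2.1 i),
    fun i => ((hys.2.1 i).rpow_const (Or.inl (hy.2.1 i).ne')).const_mul _,
    fun j => ((hxs.2.2 j).rpow_const (Or.inl (hx.2.2 j).ne')).const_mul _⟩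

theorem exists_fixed_of_multipliers {α β γ : ℝ} (hα : 0 < α) (hβ : 0 < β) {w q : Arr n m}
    (hw : Nondegenerate w) (hq : FeasibleFn w q.val) (hqi : IsInner w q.val) {lam : Fin n → ℝ}
    {mu : Fin m → ℝ} (h : Multipliers α β γ w q.val lam mu) : ∃ z, logIter α β γ w z = z := by
  have hb := h.balanced hα hβ hw.nonneg hq hqi
  have hlt := hqi.lt_one hw.nonneg hq
  have hy := hb.fixedY_pos hlt
  have hfix := hb.stepS_fixedX hq hlt
  rw [← hb.stepR_fixedY hq hlt] at hfix
  rw [Arr.eq_of_exp hy, stepR_exp _ _ _ hw, stepS_exp _ _ _ hw] at hfix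
  exact ⟨_, Arr.of_exp_injective hfix⟩

end FractionalBP

/-! ### The main theorem -/

theorem mainTheorem1 (n m : ℕ) (β γ : ℝ) (w : FractionalBP.Arr n m)
    (hβ : 1 / 2 < β) (hγ₀ : 0 ≤ γ) (hγ₁ : γ < 1) (hw : w.Nonneg)
    (hint : ∃ q, FractionalBP.InteriorFeasible w q) :
    ∃ q : FractionalBP.Arr n m,
      FractionalBP.IsMinimiser 1 β γ w q ∧
      (∀ q', FractionalBP.IsMinimiser 1 β γ w q' → q' = q) ∧
      FractionalBP.InteriorFeasible w q ∧
      ∀ y₀ : FractionalBP.Arr n m, y₀.Pos →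
        (∃ x y : FractionalBP.Arr n m, x.Pos ∧ y.Pos ∧
          FractionalBP.stepR 1 β γ w y = x ∧ FractionalBP.stepS 1 β γ w x = y ∧
          FractionalBP.Arr.ConvergesTo (FractionalBP.xMsg 1 β γ w y₀) x ∧
          FractionalBP.Arr.ConvergesTo (FractionalBP.yMsg 1 β γ w y₀) y) ∧
        FractionalBP.Arr.ConvergesTo
          (fun k => FractionalBP.beliefR 1 β w (FractionalBP.yMsg 1 β γ w y₀ k)
            (FractionalBP.xMsg 1 β γ w y₀ k)) q ∧
        FractionalBP.Arr.ConvergesTo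
          (fun k => FractionalBP.beliefS 1 β w (FractionalBP.xMsg 1 β γ w y₀ k)
            (FractionalBP.yMsg 1 β γ w y₀ (k + 1))) q := by
  open FractionalBP in
  obtain ⟨g, hg⟩ := hint
  obtain ⟨hgf, hgi⟩ := interiorFeasible_iff.1 hg
  have hw' := Arr.nonneg_iff.1 hw
  have hα : (1 / 2 : ℝ) < 1 := by norm_num
  have hnd := hgi.nondegenerate hw' hgf
  obtain ⟨f, hf⟩ := exists_isMinFn 1 β γ ⟨_, hgf⟩
  obtain ⟨q, rfl⟩ : ∃ q : Arr n m, q.val = f := ⟨Arr.of f, Arr.val_of f⟩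
  have hinner : ∀ {f}, IsMinFn 1 β γ w f → IsInner w f := fun h =>
    h.isInner hα hβ hγ₀ hγ₁ hw' hgf hgi
  have huniq : ∀ f, FeasibleFn w f → IsInner w f → Stationary 1 β γ w f → f = q.val :=
    fun f h1 h2 h3 => Stationary.eq hα hβ hγ₀ hγ₁ hw' h1 h2 h3 hf.1 (hinner hf)
      (hf.stationary hw' (hinner hf))
  refine ⟨q, isMinimiser_iff.2 hf, fun q' hq' => ?_, interiorFeasible_iff.2 ⟨hf.1, hinner hf⟩,
    fun y₀ hy₀ => ?_⟩
  · have h := isMinimiser_iff.1 hq'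
    exact Arr.val_injective (huniq _ h.1 (hinner h) (h.stationary hw' (hinner h)))
  obtain ⟨lam, mu, hmult⟩ := (hf.stationary hw' (hinner hf)).exists_multipliers
  have hβ0 : 0 < β := by linarith
  -- The minimiser supplies a fixed point; the orbit may converge to another one, `z`.
  obtain ⟨z, hz, hlim⟩ := exists_tendsto_logIter hα hβ hγ₀ hγ₁ hnd
    (exists_fixed_of_multipliers one_pos hβ0 hnd hf.1 (hinner hf) hmult)
    (fun e => Real.log (y₀.val e))
  set x : Arr n m := Arr.of (Real.exp ∘ logStepR 1 β γ w z) with hxdef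
  set y : Arr n m := Arr.of (Real.exp ∘ z) with hydef
  have hx : x.Pos := Arr.of_exp_pos _
  have hy : y.Pos := Arr.of_exp_pos _
  have hR : stepR 1 β γ w y = x := stepR_exp 1 β γ hnd z
  have hS : stepS 1 β γ w x = y := by
    rw [hxdef, stepS_exp 1 β γ hnd, ← logIter, hz]
  have hys : Arr.ConvergesTo (yMsg 1 β γ w y₀) y := by
    rw [Arr.eq_of_exp hy₀, funext (yMsg_exp 1 β γ hnd _)]
    exact Arr.convergesTo_of_exp hlim
  have hxs : Arr.ConvergesTo (xMsg 1 β γ w y₀) x := by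
    have : xMsg 1 β γ w y₀ = fun k => Arr.of (Real.exp ∘ logStepR 1 β γ w
        ((logIter 1 β γ w)^[k] fun e => Real.log (y₀.val e))) := by
      funext k
      rw [xMsg, ← stepR_exp 1 β γ hnd, ← yMsg_exp 1 β γ hnd, ← Arr.eq_of_exp hy₀]
    rw [this]
    exact Arr.convergesTo_of_exp (tendsto_logStepR hα hγ₀ hγ₁ hnd hlim)
  -- Whichever fixed point is reached, its beliefs are an inner stationary point, hence `q`.
  have hq : beliefR 1 β w y x = q := Arr.val_injective <| huniq _
    (beliefR_feasible hγ₀ hnd hx hy hR hS) (beliefR_isInner hγ₀ hnd hx hy hR hS)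
    ((beliefR_multipliers one_ne_zero hβ0.ne' hγ₀ hnd hx hy hR hS).stationary hw')
  refine ⟨⟨x, y, hx, hy, hR, hS, hxs, hys⟩, ?_, ?_⟩
  · rw [← hq]
    exact convergesTo_beliefR hx hy hxs hys
  · rw [← hq, ← beliefS_eq_beliefR hγ₀ hnd hx hy hR hS]
    have hys' : Arr.ConvergesTo (fun k => yMsg 1 β γ w y₀ (k + 1)) y :=
      Arr.convergesTo_iff.2 fun e =>
        (Arr.convergesTo_iff.1 hys e).comp (Filter.tendsto_add_atTop_nat 1)
    exact convergesTo_beliefS hx hy hxs hys'
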